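/- Let $\mathbb K$ be a field, $d\ge 0$ an integer, and index rows and columns of $(d+1)\times(d+1)$ matrices by $0,1,\dots,d$. Let $\theta_0,\dots,\theta_d\in\mathbb K$ be mutually distinct, let $\theta^*_0,\dots,\theta^*_d\in\mathbb K$ be mutually distinct, and let $\varphi_1,\dots,\varphi_d\in\mathbb K$ be nonzero. Let $A\in\mathrm{Mat}_{d+1}(\mathbb K)$ be the lower bidiagonal matrix with $A_{ii}=\theta_i$ and $A_{i,i-1}=1$, and let $A^*\in\mathrm{Mat}_{d+1}(\mathbb K)$ be the upper bidiagonal matrix with $A^*_{ii}=\theta^*_i$ and $A^*_{i-1,i}=\varphi_i$ (all other entries being $0$; $A^*$ is just a name, not an adjoint). For $0\le i\le d$ let $$E_i=\prod_{j\ne i}\frac{A-\theta_jI}{\theta_i-\theta_j},\qquad E^*_i=\prod_{j\ne i}\frac{A^*-\theta^*_jI}{\theta^*_i-\theta^*_j}$$ be the primitive idempotents of $A$ and $A^*$ associated with $\theta_i$ and $\theta^*_i$. *Definitions.* A square matrix is irreducible tridiagonal if all its nonzero entries lie on the diagonal, the subdiagonal and the superdiagonal, and all its subdiagonal and superdiagonal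 entries are nonzero. The pair $A,A^*$ is a *Leonard pair* if $\mathbb K^{d+1}$ has a basis with respect to which $A$ is represented by an irreducible tridiagonal matrix and $A^*$ by a diagonal one, and a basis with respect to which $A^*$ is represented by an irreducible tridiagonal matrix and $A$ by a diagonal one. The sequence $\Phi=(A;\{E_i\}_{i=0}^d;A^*;\{E^*_i\}_{i=0}^d)$ is a *Leonard system* if each of $A$, $A^*$ has $d+1$ distinct eigenvalues in $\mathbb K$, $\{E_i\}$ and $\{E^*_i\}$ are orderings of the primitive idempotents of $A$ and of $A^*$, and, for all $0\le i,j\le d$, each of $E_iA^*E_j$ and $E^*_iAE^*_j$ is $0$ if $|i-j|>1$ and nonzero if $|i-j|=1$. In that case its *first* and *second split sequences* are, for $1\le i\le d$, $$(\theta^*_0-\theta^*_i)\frac{\operatorname{tr}(\tau_i(A)E^*_0)}{\operatorname{tr}(\tau_{i-1}(A)E^*_0)}\qquad\text{and}\qquad(\theta^*_0-\theta^*_i)\frac{\operatorname{tr}(\eta_i(A)E^*_0)}{\operatorname{tr}(\eta_{i-1}(A)E^*_0)},$$ where $\tau_i(\lambda)=\prod_{h=0}^{i-1}(\lambda-\theta_h)$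 and $\eta_i(\lambda)=\prod_{h=0}^{i-1}(\lambda-\theta_{d-h})$. Writing $\{\varphi'_i\}_{i=1}^d$ and $\{\phi'_i\}_{i=1}^d$ for these two sequences, the *switching element* of $\Phi$ is $$S=\sum_{r=0}^d\frac{\phi'_d\phi'_{d-1}\cdots\phi'_{d-r+1}}{\varphi'_1\varphi'_2\cdots\varphi'_r}E_r .$$ **Theorem.** The following (i), (ii) are equivalent. (i) The pair $A,A^*$ is a Leonard pair. (ii) There exist an invertible $X\in\mathrm{Mat}_{d+1}(\mathbb K)$ and nonzero scalars $\phi_1,\dots,\phi_d\in\mathbb K$ such that $X^{-1}AX=A$ and $X^{-1}A^*X$ is the upper bidiagonal matrix with diagonal $\theta^*_d,\theta^*_{d-1},\dots,\theta^*_0$ and superdiagonal $\phi_d,\phi_{d-1},\dots,\phi_1$ (read from the top left). Suppose (i), (ii) hold. Then $\Phi$ is a Leonard system and, for all $X$ and $\{\phi_i\}_{i=1}^d$ as in (ii), $\{\phi_i\}_{i=1}^d$ is the second split sequence of $\Phi$ and $X$ is a scalar multiple of the switching element $S$ of $\Phi$. -/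

import Mathlib

namespace LeonardPairs

open Polynomial

/-- A square matrix is irreducible tridiagonal if every nonzero entry lies on the diagonal, the
subdiagonal or the superdiagonal, and all entries on the subdiagonal and on the superdiagonal
are nonzero. -/
def IsIrredTridiagonal {K : Type*} [Field K] {d : ℕ}
    (M : Matrix (Fin (d + 1)) (Fin (d + 1)) K) : Prop :=
  (∀ i j : Fin (d + 1), (i : ℕ) + 1 < j ∨ (j : ℕ) + 1 < i → M i j = 0) ∧
  (∀ i j : Fin (d + 1), (i : ℕ) + 1 = j ∨ (j : ℕ) + 1 = i → M i j ≠ 0)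

/-- The ordered pair `A, B` of linear maps is a Leonard pair on `V`. The existence of a basis
indexed by `Fin (d + 1)` says that `V` has finite positive dimension `d + 1`. -/
def IsLeonardPair {K V : Type*} [Field K] [AddCommGroup V] [Module K V]
    (A B : V →ₗ[K] V) : Prop :=
  ∃ d : ℕ,
    (∃ v : Module.Basis (Fin (d + 1)) K V,
      IsIrredTridiagonal (LinearMap.toMatrix v v A) ∧ (LinearMap.toMatrix v v B).IsDiag) ∧
    (∃ w : Module.Basis (Fin (d + 1)) K V,
      IsIrredTridiagonal (LinearMap.toMatrix w w B) ∧ (LinearMap.toMatrix w w A).IsDiag)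

section Systems

variable {K : Type*} [Field K] {d : ℕ}

/-- `θ` is an ordering of the `d + 1` mutually distinct eigenvalues of `A`. -/
def IsEigenvalueOrdering (A : Matrix (Fin (d + 1)) (Fin (d + 1)) K)
    (θ : Fin (d + 1) → K) : Prop :=
  Function.Injective θ ∧ ∀ i, Module.End.HasEigenvalue (Matrix.toLin' A) (θ i)

/-- `A` has `d + 1` mutually distinct eigenvalues in `K`. -/
def IsMultiplicityFree (A : Matrix (Fin (d + 1)) (Fin (d + 1)) K) : Prop :=
  ∃ θ : Fin (d + 1) → K, IsEigenvalueOrdering A θ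

/-- The primitive idempotent `∏_{j ≠ i} (A - θ_j I) / (θ_i - θ_j)` of `A` associated with `θ_i`:
`Lagrange.basis Finset.univ θ i` is the polynomial `∏_{j ≠ i} (X - θ_j) / (θ_i - θ_j)`. -/
noncomputable def primitiveIdempotent (A : Matrix (Fin (d + 1)) (Fin (d + 1)) K)
    (θ : Fin (d + 1) → K) (i : Fin (d + 1)) : Matrix (Fin (d + 1)) (Fin (d + 1)) K :=
  aeval A (Lagrange.basis Finset.univ θ i)

/-- `E` is an ordering of the primitive idempotents of `A`. -/
def IsIdempotentOrdering (A : Matrix (Fin (d + 1)) (Fin (d + 1)) K)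
    (E : Fin (d + 1) → Matrix (Fin (d + 1)) (Fin (d + 1)) K) : Prop :=
  ∃ θ : Fin (d + 1) → K, IsEigenvalueOrdering A θ ∧ ∀ i, E i = primitiveIdempotent A θ i

/-- The sequence `(A; {E_i}; B; {F_i})` is a Leonard system in the algebra of
`(d + 1) × (d + 1)` matrices (`B` and `F` stand for `A^*` and `E^*`). -/
structure IsLeonardSystem (A : Matrix (Fin (d + 1)) (Fin (d + 1)) K)
    (E : Fin (d + 1) → Matrix (Fin (d + 1)) (Fin (d + 1)) K)
    (B : Matrix (Fin (d + 1)) (Fin (d + 1)) K)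
    (F : Fin (d + 1) → Matrix (Fin (d + 1)) (Fin (d + 1)) K) : Prop where
  multiplicityFree : IsMultiplicityFree A
  multiplicityFree_dual : IsMultiplicityFree B
  idempotents : IsIdempotentOrdering A E
  idempotents_dual : IsIdempotentOrdering B F
  dual_eq_zero : ∀ i j : Fin (d + 1),
    (i : ℕ) + 1 < j ∨ (j : ℕ) + 1 < i → E i * B * E j = 0
  dual_ne_zero : ∀ i j : Fin (d + 1),
    (i : ℕ) + 1 = j ∨ (j : ℕ) + 1 = i → E i * B * E j ≠ 0
  eq_zero : ∀ i j : Fin (d + 1),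
    (i : ℕ) + 1 < j ∨ (j : ℕ) + 1 < i → F i * A * F j = 0
  ne_zero : ∀ i j : Fin (d + 1),
    (i : ℕ) + 1 = j ∨ (j : ℕ) + 1 = i → F i * A * F j ≠ 0

/-- The eigenvalue of `A` associated with the primitive idempotent `E_i`: the scalar `t` with
`A E_i = t E_i` (unique because `E_i ≠ 0`). -/
noncomputable def eigenvalueSeq (A : Matrix (Fin (d + 1)) (Fin (d + 1)) K)
    (E : Fin (d + 1) → Matrix (Fin (d + 1)) (Fin (d + 1)) K) (i : Fin (d + 1)) : K :=
  Classical.epsilon fun t : K => A * E i = t • E i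

/-- `τ_i = (X - θ_0)(X - θ_1) ⋯ (X - θ_{i-1})`. -/
noncomputable def tau (θ : Fin (d + 1) → K) (i : ℕ) : K[X] :=
  ∏ h ∈ Finset.univ.filter (fun h : Fin (d + 1) => (h : ℕ) < i), (X - C (θ h))

/-- `η_i = (X - θ_d)(X - θ_{d-1}) ⋯ (X - θ_{d-i+1})`. -/
noncomputable def eta (θ : Fin (d + 1) → K) (i : ℕ) : K[X] :=
  ∏ h ∈ Finset.univ.filter (fun h : Fin (d + 1) => (h : ℕ) < i), (X - C (θ h.rev))

/-- The first split sequence of `(A; {E_i}; B; {F_i})`. The value at `k : Fin d` is the member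
with number `i = k + 1`, namely
`(θ^*_0 - θ^*_i) tr(τ_i(A) F_0) / tr(τ_{i-1}(A) F_0)`. -/
noncomputable def firstSplitSeq (A : Matrix (Fin (d + 1)) (Fin (d + 1)) K)
    (E : Fin (d + 1) → Matrix (Fin (d + 1)) (Fin (d + 1)) K)
    (B : Matrix (Fin (d + 1)) (Fin (d + 1)) K)
    (F : Fin (d + 1) → Matrix (Fin (d + 1)) (Fin (d + 1)) K) (k : Fin d) : K :=
  (eigenvalueSeq B F 0 - eigenvalueSeq B F k.succ) *
    (Matrix.trace (aeval A (tau (eigenvalueSeq A E) (k + 1)) * F 0) /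
      Matrix.trace (aeval A (tau (eigenvalueSeq A E) k) * F 0))

/-- The second split sequence of `(A; {E_i}; B; {F_i})`. The value at `k : Fin d` is the member
with number `i = k + 1`, namely
`(θ^*_0 - θ^*_i) tr(η_i(A) F_0) / tr(η_{i-1}(A) F_0)`. -/
noncomputable def secondSplitSeq (A : Matrix (Fin (d + 1)) (Fin (d + 1)) K)
    (E : Fin (d + 1) → Matrix (Fin (d + 1)) (Fin (d + 1)) K)
    (B : Matrix (Fin (d + 1)) (Fin (d + 1)) K)
    (F : Fin (d + 1) → Matrix (Fin (d + 1)) (Fin (d + 1)) K) (k : Fin d) : K :=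
  (eigenvalueSeq B F 0 - eigenvalueSeq B F k.succ) *
    (Matrix.trace (aeval A (eta (eigenvalueSeq A E) (k + 1)) * F 0) /
      Matrix.trace (aeval A (eta (eigenvalueSeq A E) k) * F 0))

/-- The switching element
`S = ∑_{r=0}^d (ϕ_d ϕ_{d-1} ⋯ ϕ_{d-r+1}) / (φ_1 φ_2 ⋯ φ_r) E_r`, where `φ` and `ϕ` are the first
and the second split sequence of `(A; {E_i}; B; {F_i})`. -/
noncomputable def switchingElement (A : Matrix (Fin (d + 1)) (Fin (d + 1)) K)
    (E : Fin (d + 1) → Matrix (Fin (d + 1)) (Fin (d + 1)) K)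
    (B : Matrix (Fin (d + 1)) (Fin (d + 1)) K)
    (F : Fin (d + 1) → Matrix (Fin (d + 1)) (Fin (d + 1)) K) :
    Matrix (Fin (d + 1)) (Fin (d + 1)) K :=
  ∑ r : Fin (d + 1),
    ((∏ h ∈ Finset.univ.filter (fun h : Fin d => (h : ℕ) < r), secondSplitSeq A E B F h.rev) /
      (∏ h ∈ Finset.univ.filter (fun h : Fin d => (h : ℕ) < r), firstSplitSeq A E B F h)) • E r

/-- The lower bidiagonal matrix with diagonal `θ_0, …, θ_d` and all subdiagonal entries `1`. -/
def lowerBidiagonal (θ : Fin (d + 1) → K) : Matrix (Fin (d + 1)) (Fin (d + 1)) K :=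
  Matrix.of fun i j => if i = j then θ i else if (i : ℕ) = j + 1 then 1 else 0

/-- The upper bidiagonal matrix with diagonal `a 0, …, a d` and superdiagonal
`b 0, …, b (d - 1)`, the entry in position `(i, i + 1)` being `b i`. -/
def upperBidiagonal (a : Fin (d + 1) → K) (b : Fin d → K) :
    Matrix (Fin (d + 1)) (Fin (d + 1)) K :=
  Matrix.of fun i j =>
    if i = j then a i
    else if h : (j : ℕ) = i + 1 then b ⟨i, by omega⟩ else 0

end Systems

end LeonardPairs

/-! Triangularity supplies a lower unitriangular `P` with `A P = P diag(θ)` and an upper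
unitriangular `Q` with `A* Q = Q diag(θ*)`. Put `M = P⁻¹ A* P` and `N = Q⁻¹ A Q`. Unitriangular
conjugation keeps the entries of `A*` above the diagonal and those of `A` below it, so half of the
tridiagonal shape of `M` and `N` is automatic; each of (i), (ii) supplies the other half.

From (i): a basis diagonalizing `A*` is unique up to order and scaling, so `N` has a tridiagonal
pattern up to a permutation. Its nonzero subdiagonal forces the permutation to be the identity or
the reversal. The same holds for `M` (`isIrredTridiagonal_of_perm`).

From tridiagonal `M`, `N` to (ii): `X` is the polynomial in `A` that sends `e_0` to the eigenvector
of `A*` for `θ*_d`. Relative to the reversed eigenbasis of `A*`, `X` is upper triangular, which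
makes `X⁻¹ A* X` upper triangular with reversed diagonal. Since `X` is also diagonal in the
eigenbasis of `A`, the entries of `X⁻¹ A* X` above the diagonal are those of a rescaled `M`, so it
is bidiagonal (`exists_switching`).

From (ii): diagonalizing `X⁻¹ A* X` gives `N` a second Hessenberg shape, in reversed order, so `N`
is tridiagonal. A tridiagonal `N` is symmetrizable, and this transfers to a symmetric zero pattern
for `M` (`symm_zero_of_intertwine`).

The split sequences come from two-term recurrences for the coordinates of eigenvectors of bidiagonal
matrices. Comparing superdiagonals in `A* X = X (X⁻¹ A* X)` determines the eigenvalues of `X` up to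
one scalar. -/

namespace LeonardPairs

open Polynomial Matrix

/-! ### Diagonalized matrices and intertwiners. -/

section Diagonalization

variable {K n : Type*} [Field K] [Fintype n] [DecidableEq n]

theorem aeval_eq_of_mul_eq {M P : Matrix n n K} {a : n → K} (hP : IsUnit P)
    (h : M * P = P * diagonal a) (p : K[X]) :
    aeval M p = P * diagonal (fun i => p.eval (a i)) * P⁻¹ := by
  have hdet := (isUnit_iff_isUnit_det P).1 hP
  have key : aeval M p * P = P * diagonal (fun i => p.eval (a i)) := by
    induction p using Polynomial.induction_on' with
    | add p q hp hq =>
      simp only [map_add, add_mul, hp, hq, eval_add, ← mul_add, diagonal_add]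
    | monomial k c =>
      have hk : M ^ k * P = P * diagonal (fun i => a i ^ k) := by
        induction k with
        | zero => simp
        | succ k ih =>
          rw [pow_succ, mul_assoc, h, ← mul_assoc, ih, mul_assoc, diagonal_mul_diagonal]
          simp only [pow_succ]
      rw [aeval_monomial, mul_assoc, hk, ← Algebra.smul_def, ← Matrix.mul_smul, ← diagonal_smul]
      simp [eval_monomial, Pi.smul_def]
  rw [← key, mul_assoc, mul_nonsing_inv _ hdet, mul_one]

/-- A matrix commuting with a diagonal matrix with distinct entries is diagonal. -/
theorem eq_diagonal_of_commute {Y : Matrix n n K} {a : n → K} (ha : Function.Injective a)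
    (h : diagonal a * Y = Y * diagonal a) : Y = diagonal (fun i => Y i i) := by
  ext i j
  rcases eq_or_ne i j with rfl | hij
  · simp
  · have := congrFun (congrFun h i) j
    rw [diagonal_mul, mul_diagonal] at this
    have h2 : (a i - a j) * Y i j = 0 := by linear_combination this
    rw [diagonal_apply_ne _ hij]
    exact (mul_eq_zero.1 h2).resolve_left (sub_ne_zero.2 (ha.ne hij))

/-- An invertible matrix intertwining two diagonal matrices, the first with distinct entries,
is monomial, so conjugation by it permutes the zero pattern of a matrix. -/
theorem exists_perm_of_intertwine {N T C : Matrix n n K} {a b : n → K}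
    (ha : Function.Injective a) (hC : IsUnit C) (h : diagonal a * C = C * diagonal b)
    (hN : N * C = C * T) :
    ∃ σ : Equiv.Perm n, (∀ j, a (σ j) = b j) ∧ ∀ i j, N (σ i) (σ j) = 0 ↔ T i j = 0 := by
  have hdet := (isUnit_iff_isUnit_det C).1 hC
  have hcol : ∀ j, ∃ i, C i j ≠ 0 := by
    intro j
    by_contra! hj
    exact hdet.ne_zero (det_eq_zero_of_column_eq_zero j hj)
  have hrow : ∀ i, ∃ j, C i j ≠ 0 := by
    intro i
    by_contra! hi
    exact hdet.ne_zero (det_eq_zero_of_row_eq_zero i hi)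
  -- With `a` injective, this leaves at most one nonzero entry in each column of `C`.
  have hab : ∀ i j, C i j ≠ 0 → a i = b j := by
    intro i j hij
    have := congrFun (congrFun h i) j
    rw [diagonal_mul, mul_diagonal, mul_comm] at this
    exact mul_left_cancel₀ hij this
  choose σ hσ using hcol
  have huniq : ∀ i j, C i j ≠ 0 → i = σ j := fun i j hij =>
    ha ((hab i j hij).trans (hab _ j (hσ j)).symm)
  have hsurj : Function.Surjective σ := fun i => by
    obtain ⟨j, hj⟩ := hrow i
    exact ⟨j, (huniq i j hj).symm⟩
  have hbij : Function.Bijective σ := Finite.surjective_iff_bijective.1 hsurj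
  refine ⟨Equiv.ofBijective σ hbij, fun j => hab _ _ (hσ j), fun i j => ?_⟩
  simp only [Equiv.ofBijective_apply]
  have hC0 : ∀ k l, k ≠ σ l → C k l = 0 := fun k l hkl => by
    by_contra hne
    exact hkl (huniq k l hne)
  -- Both sums collapse: `N (σ i) (σ j) * C (σ j) j = C (σ i) i * T i j`.
  have := congrFun (congrFun hN (σ i)) j
  rw [mul_apply, mul_apply,
    Finset.sum_eq_single (σ j) (fun k _ hk => by rw [hC0 k j hk, mul_zero]) (by simp),
    Finset.sum_eq_single i
      (fun k _ hk => by rw [hC0 (σ i) k (fun e => hk (hbij.1 e).symm), zero_mul]) (by simp)] at this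
  constructor
  · intro h0
    rw [h0, zero_mul] at this
    exact (mul_eq_zero.1 this.symm).resolve_left (hσ i)
  · intro h0
    rw [h0, mul_zero] at this
    exact (mul_eq_zero.1 this).resolve_right (hσ j)

end Diagonalization

/-! ### Triangular matrices and their eigenvectors. -/

section Triangular

variable {K : Type*} [Field K] {m : ℕ}

/-- Lower triangular with all diagonal entries `1`. -/
structure IsLowerUnitriangular (P : Matrix (Fin m) (Fin m) K) : Prop where
  eq_zero : ∀ i j, i < j → P i j = 0
  diag : ∀ i, P i i = 1

theorem mul_apply_diag_of_upper {M N : Matrix (Fin m) (Fin m) K} (hM : M.IsUpperTriangular)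
    (hN : N.IsUpperTriangular) (i : Fin m) : (M * N) i i = M i i * N i i := by
  rw [mul_apply]
  refine Finset.sum_eq_single i (fun k _ hk => ?_) (by simp)
  rcases lt_or_gt_of_ne hk with h | h
  · rw [hM (show id k < id i from h), zero_mul]
  · rw [hN (show id i < id k from h), mul_zero]

theorem aeval_upper {M : Matrix (Fin m) (Fin m) K} (hM : M.IsUpperTriangular) (p : K[X]) :
    (aeval M p).IsUpperTriangular ∧ ∀ i, aeval M p i i = p.eval (M i i) := by
  induction p using Polynomial.induction_on' with
  | add p q hp hq =>
    rw [map_add]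
    exact ⟨hp.1.add hq.1, fun i => by rw [Matrix.add_apply, hp.2, hq.2, eval_add]⟩
  | monomial k c =>
    have hk : (M ^ k).IsUpperTriangular ∧ ∀ i, (M ^ k) i i = M i i ^ k := by
      induction k with
      | zero => exact ⟨by rw [pow_zero]; exact blockTriangular_one, by simp⟩
      | succ k ih =>
        rw [pow_succ]
        exact ⟨ih.1.mul hM, fun i => by rw [mul_apply_diag_of_upper ih.1 hM, ih.2, pow_succ]⟩
    rw [aeval_monomial, ← Algebra.smul_def]
    refine ⟨fun i j hij => ?_, fun i => ?_⟩
    · rw [Matrix.smul_apply, hk.1 hij, smul_zero]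
    · rw [Matrix.smul_apply, hk.2, eval_monomial, smul_eq_mul]

theorem IsLowerUnitriangular.isUnit {P : Matrix (Fin m) (Fin m) K}
    (hP : IsLowerUnitriangular P) : IsUnit P := by
  rw [isUnit_iff_isUnit_det, det_of_isLowerTriangular P (fun i j h => hP.eq_zero i j h)]
  simp [hP.diag]

theorem isUpperTriangular_inv {U : Matrix (Fin m) (Fin m) K} (hU : U.IsUpperTriangular)
    (hu : IsUnit U) : U⁻¹.IsUpperTriangular := by
  have := hu.invertible
  exact blockTriangular_inv_of_blockTriangular hU

theorem IsLowerUnitriangular.inv {P : Matrix (Fin m) (Fin m) K}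
    (hP : IsLowerUnitriangular P) : IsLowerUnitriangular P⁻¹ := by
  have hu := (isUnit_iff_isUnit_det _).1 hP.isUnit
  have hT : Pᵀ.IsUpperTriangular := fun i j h => hP.eq_zero j i h
  have hT' : (P⁻¹)ᵀ.BlockTriangular id := by
    rw [transpose_nonsing_inv]
    exact isUpperTriangular_inv hT ((isUnit_transpose _).2 hP.isUnit)
  refine ⟨fun i j h => hT' (i := j) (j := i) h, fun i => ?_⟩
  have h1 := mul_apply_diag_of_upper hT hT' i
  rw [← transpose_mul, nonsing_inv_mul _ hu] at h1
  simpa [hP.diag] using h1.symm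

/-- Eigenvectors of an upper triangular matrix with distinct diagonal entries. -/
theorem exists_diagonalizer_upper {M : Matrix (Fin m) (Fin m) K} (hM : M.IsUpperTriangular)
    {a : Fin m → K} (ha : Function.Injective a) (hMa : ∀ i, M i i = a i) :
    ∃ Q : Matrix (Fin m) (Fin m) K, IsLowerUnitriangular Qᵀ ∧ M * Q = Q * diagonal a := by
  -- By Cayley–Hamilton every column of `F j` is killed by `M - a j`. Column `j` has `j`-th entry
  -- `1`, hence is a normalized eigenvector.
  let F := fun j => aeval M (Lagrange.basis Finset.univ a j)
  have hinj : Set.InjOn a (Finset.univ : Finset (Fin m)) := ha.injOn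
  have hroot : ∀ j, M * F j = a j • F j := by
    intro j
    have hnodal : aeval M (Lagrange.nodal Finset.univ a) = 0 := by
      have h := aeval_self_charpoly M
      rw [charpoly_of_isUpperTriangular M hM] at h
      simpa only [Lagrange.nodal, hMa] using h
    have hpoly : (X - C (a j)) * Lagrange.basis Finset.univ a j =
        C (Lagrange.nodalWeight Finset.univ a j) * Lagrange.nodal Finset.univ a := by
      rw [Lagrange.basis_eq_prod_sub_inv_mul_nodal_div (Finset.mem_univ j),
        ← Lagrange.nodal_erase_eq_nodal_div (Finset.mem_univ j),
        Lagrange.nodal_eq_mul_nodal_erase (Finset.mem_univ j)]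
      ring
    have h := congrArg (aeval M) hpoly
    rw [map_mul, map_mul, hnodal, mul_zero, map_sub, aeval_X, aeval_C, sub_mul,
      ← Algebra.smul_def] at h
    exact sub_eq_zero.1 h
  refine ⟨of fun i j => F j i j, ⟨fun i j h => (aeval_upper hM _).1 h, fun i => ?_⟩, ?_⟩
  · simp only [transpose_apply, of_apply, F]
    rw [(aeval_upper hM _).2, hMa, Lagrange.eval_basis_self hinj (Finset.mem_univ i)]
  · ext i j
    rw [mul_diagonal]
    have := congrFun (congrFun (hroot j) i) j
    rw [mul_apply] at this ⊢
    simpa [mul_comm] using this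

/-- The upper triangular case for the transpose gives left eigenvectors as the rows of `Qᵀ`;
inverting turns them into right eigenvectors. -/
theorem exists_diagonalizer_lower {M : Matrix (Fin m) (Fin m) K}
    (hM : ∀ i j, i < j → M i j = 0)
    {a : Fin m → K} (ha : Function.Injective a) (hMa : ∀ i, M i i = a i) :
    ∃ P : Matrix (Fin m) (Fin m) K, IsLowerUnitriangular P ∧ M * P = P * diagonal a := by
  obtain ⟨Q, hQ, h⟩ := exists_diagonalizer_upper (M := Mᵀ) (fun i j h => hM j i h) ha hMa
  have hu := (isUnit_iff_isUnit_det _).1 hQ.isUnit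
  refine ⟨Qᵀ⁻¹, hQ.inv, ?_⟩
  have h' : Qᵀ * M = diagonal a * Qᵀ := by
    simpa [transpose_mul] using congrArg transpose h
  calc M * Qᵀ⁻¹ = Qᵀ⁻¹ * (Qᵀ * M) * Qᵀ⁻¹ := by
        rw [← mul_assoc, nonsing_inv_mul _ hu, one_mul]
    _ = Qᵀ⁻¹ * diagonal a := by
        rw [h', mul_assoc, mul_assoc, mul_nonsing_inv _ hu, mul_one]

/-- Multiplying by lower unitriangular matrices on both sides preserves the part of a lower
Hessenberg matrix strictly above the diagonal. -/
theorem unitriangular_mul_hessenberg_mul {L L' U : Matrix (Fin m) (Fin m) K}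
    (hL : IsLowerUnitriangular L) (hL' : IsLowerUnitriangular L')
    (hU : ∀ i j : Fin m, (i : ℕ) + 1 < j → U i j = 0) {i j : Fin m} (hij : (i : ℕ) + 1 ≤ j) :
    (L * U * L') i j = U i j := by
  have h1 : ∀ i j : Fin m, (i : ℕ) + 1 ≤ j → (L * U) i j = U i j := by
    intro i j hij
    rw [mul_apply, Finset.sum_eq_single i _ (by simp), hL.diag, one_mul]
    intro k _ hk
    rcases lt_or_gt_of_ne hk with h | h
    · rw [hU k j (by have : (k : ℕ) < i := h; omega), mul_zero]
    · rw [hL.eq_zero i k h, zero_mul]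
  rw [mul_apply, Finset.sum_eq_single j _ (by simp), hL'.diag, mul_one, h1 i j hij]
  intro k _ hk
  rcases lt_or_gt_of_ne hk with h | h
  · rw [hL'.eq_zero k j h, mul_zero]
  · have : (j : ℕ) < k := h
    rw [h1 i k (by omega), hU i k (by omega), zero_mul]

end Triangular

/-! ### Walks on the integers. -/

section PathLemma

/-- An injective integer sequence with steps `±1` is monotone with constant step. -/
theorem exists_sign_of_injective_unit_steps {d : ℕ} (f : Fin (d + 1) → ℤ)
    (hf : Function.Injective f)
    (h : ∀ i j : Fin (d + 1), (i : ℕ) + 1 = j → f j - f i = 1 ∨ f j - f i = -1) :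
    ∃ ε : ℤ, (ε = 1 ∨ ε = -1) ∧ ∀ i j, f i - f j = ε * ((i : ℤ) - j) := by
  have key : ∃ ε : ℤ, (ε = 1 ∨ ε = -1) ∧
      ∀ k (hk : k + 1 < d + 1), f ⟨k + 1, hk⟩ - f ⟨k, by omega⟩ = ε := by
    rcases Nat.eq_zero_or_pos d with rfl | hd
    · exact ⟨1, Or.inl rfl, fun k hk => by omega⟩
    · refine ⟨f ⟨1, by omega⟩ - f ⟨0, by omega⟩, h _ _ rfl, fun k => ?_⟩
      induction k with
      | zero => intro _; rfl
      | succ k ih =>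
        intro hk
        have h1 := ih (by omega)
        have h2 := h ⟨k + 1, by omega⟩ ⟨k + 1 + 1, hk⟩ rfl
        have h3 := h ⟨0, by omega⟩ ⟨1, by omega⟩ rfl
        -- Injectivity forbids turning back, so the next step has the same sign.
        have h4 : f ⟨k + 1 + 1, hk⟩ ≠ f ⟨k, by omega⟩ := fun e => by
          have : k + 1 + 1 = k := congrArg Fin.val (hf e)
          omega
        omega
  obtain ⟨ε, hε, hstep⟩ := key
  have h0 : ∀ k (hk : k < d + 1), f ⟨k, hk⟩ = f 0 + ε * k := by
    intro k
    induction k with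
    | zero => intro _; simp
    | succ k ih =>
      intro hk
      have h1 := hstep k hk
      have h2 := ih (by omega)
      push_cast
      linarith
  exact ⟨ε, hε, fun i j => by linear_combination h0 i i.2 - h0 j j.2⟩

end PathLemma

/-! ### Irreducible tridiagonal matrices. -/

section Tridiagonal

variable {K : Type*} [Field K] {d : ℕ}

theorem IsIrredTridiagonal.transpose {M : Matrix (Fin (d + 1)) (Fin (d + 1)) K}
    (h : IsIrredTridiagonal M) : IsIrredTridiagonal Mᵀ :=
  ⟨fun i j hij => h.1 j i hij.symm, fun i j hij => h.2 j i hij.symm⟩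

/-- If a matrix has the zero pattern of an irreducible tridiagonal matrix up to a permutation,
and each pair of neighbours is linked by a nonzero entry, then it is irreducible tridiagonal. -/
theorem isIrredTridiagonal_of_perm {N T : Matrix (Fin (d + 1)) (Fin (d + 1)) K}
    (hT : IsIrredTridiagonal T) (σ : Equiv.Perm (Fin (d + 1)))
    (hσ : ∀ i j, N (σ i) (σ j) = 0 ↔ T i j = 0)
    (hN : ∀ i j : Fin (d + 1), (i : ℕ) + 1 = j → N j i ≠ 0) : IsIrredTridiagonal N := by
  have hτ : ∀ i j, N i j = 0 ↔ T (σ.symm i) (σ.symm j) = 0 := fun i j => by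
    simpa using hσ (σ.symm i) (σ.symm j)
  -- A nonzero entry of `T` off the diagonal joins neighbours, so `σ.symm` moves by unit steps and
  -- preserves all distances.
  obtain ⟨ε, hε, h⟩ := exists_sign_of_injective_unit_steps
    (fun i => ((σ.symm i : ℕ) : ℤ)) (fun i j hij => by
      simp only [Nat.cast_inj] at hij
      exact σ.symm.injective (Fin.ext hij)) (fun i j hij => by
      have h1 : T (σ.symm j) (σ.symm i) ≠ 0 := fun h0 => hN i j hij ((hτ _ _).2 h0)
      have h2 : ¬ (((σ.symm j : ℕ) + 1 < σ.symm i) ∨ ((σ.symm i : ℕ) + 1 < σ.symm j)) :=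
        fun h0 => h1 (hT.1 _ _ h0)
      have h3 : (σ.symm j : ℕ) ≠ σ.symm i := fun e => by
        have := congrArg Fin.val (σ.symm.injective (Fin.ext e))
        omega
      omega)
  constructor
  · intro i j hij
    refine (hτ i j).2 (hT.1 _ _ ?_)
    have := h i j
    rcases hε with rfl | rfl <;> omega
  · intro i j hij h0
    refine hT.2 _ _ ?_ ((hτ i j).1 h0)
    have := h i j
    rcases hε with rfl | rfl <;> omega

/-- An irreducible tridiagonal matrix is symmetrizable by an invertible diagonal matrix. -/
theorem IsIrredTridiagonal.exists_symmetrizer {N : Matrix (Fin (d + 1)) (Fin (d + 1)) K}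
    (hN : IsIrredTridiagonal N) :
    ∃ s : Fin (d + 1) → K, (∀ i, s i ≠ 0) ∧ N * diagonal s = diagonal s * Nᵀ := by
  -- The recursion is forced by `N i j * t j = t i * N j i` with `j = i + 1`; the value `1` past the
  -- last index is never used.
  let t : ℕ → K := fun k => Nat.rec 1
    (fun k r => if h : k + 1 < d + 1 then
      r * N ⟨k + 1, h⟩ ⟨k, by omega⟩ / N ⟨k, by omega⟩ ⟨k + 1, h⟩ else 1) k
  have ht : ∀ k (h : k + 1 < d + 1),
      t (k + 1) = t k * N ⟨k + 1, h⟩ ⟨k, by omega⟩ / N ⟨k, by omega⟩ ⟨k + 1, h⟩ := by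
    intro k h
    simp only [t]
    rw [dif_pos h]
  have hne : ∀ k, k < d + 1 → t k ≠ 0 := by
    intro k
    induction k with
    | zero => intro _; exact one_ne_zero
    | succ k ih =>
      intro hk
      rw [ht k hk]
      exact div_ne_zero (mul_ne_zero (ih (by omega)) (hN.2 _ _ (Or.inr rfl)))
        (hN.2 _ _ (Or.inl rfl))
  have hstep : ∀ i j : Fin (d + 1), (i : ℕ) + 1 = j → N i j * t j = t i * N j i := by
    rintro ⟨i, hi⟩ ⟨j, hj⟩ hij
    simp only at hij
    subst hij
    have h0 : N ⟨i, hi⟩ ⟨i + 1, hj⟩ ≠ 0 := hN.2 _ _ (Or.inl rfl)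
    simp only
    rw [ht i hj]
    field_simp
  refine ⟨fun i => t i, fun i => hne i i.2, ?_⟩
  ext i j
  rw [mul_diagonal, diagonal_mul, transpose_apply]
  rcases lt_trichotomy (i : ℕ) j with h | h | h
  · rcases (Nat.succ_le_of_lt h).eq_or_lt with h1 | h1
    · exact hstep i j h1
    · rw [hN.1 i j (Or.inl h1), hN.1 j i (Or.inr h1), zero_mul, mul_zero]
  · rw [Fin.ext h, mul_comm]
  · rcases (Nat.succ_le_of_lt h).eq_or_lt with h1 | h1
    · linear_combination -hstep j i h1
    · rw [hN.1 i j (Or.inr h1), hN.1 j i (Or.inl h1), zero_mul, mul_zero]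

/-- Let `W` intertwine both `M` with a diagonal matrix and a diagonal matrix with `N`. If `N` is
irreducible tridiagonal, the antiautomorphism fixing both shows that `M` has a symmetric
zero pattern. -/
theorem symm_zero_of_intertwine {M N W : Matrix (Fin (d + 1)) (Fin (d + 1)) K}
    {a b : Fin (d + 1) → K} (ha : Function.Injective a) (hN : IsIrredTridiagonal N)
    (hW : IsUnit W) (hMW : M * W = W * diagonal b) (hWN : diagonal a * W = W * N)
    (i j : Fin (d + 1)) : M i j = 0 ↔ M j i = 0 := by
  obtain ⟨s, hs, hsN⟩ := hN.exists_symmetrizer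
  -- `Y` commutes with `diagonal a`, hence is diagonal, and `M * Y = Y * Mᵀ` then reads `M i j * Y j
  -- j = Y i i * M j i`.
  let Y := W * diagonal s * Wᵀ
  have hWN' : Wᵀ * diagonal a = Nᵀ * Wᵀ := by
    simpa [transpose_mul] using congrArg Matrix.transpose hWN
  have hMW' : Wᵀ * Mᵀ = diagonal b * Wᵀ := by
    simpa [transpose_mul] using congrArg Matrix.transpose hMW
  have hY : diagonal a * Y = Y * diagonal a := by
    simp only [Y]
    rw [mul_assoc _ Wᵀ, hWN', ← mul_assoc, ← mul_assoc, hWN, mul_assoc W N, hsN]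
    simp only [mul_assoc]
  have hMY : M * Y = Y * Mᵀ := by
    simp only [Y]
    rw [mul_assoc _ Wᵀ, hMW', ← mul_assoc, ← mul_assoc, hMW, mul_assoc W (diagonal b), mul_assoc W,
      mul_assoc W (diagonal s), diagonal_mul_diagonal, ← mul_assoc (diagonal s),
      diagonal_mul_diagonal]
    simp only [mul_comm (b _)]
  have hYd := eq_diagonal_of_commute ha hY
  have hYu : IsUnit Y := by
    refine (hW.mul ?_).mul ((isUnit_transpose W).2 hW)
    rw [isUnit_iff_isUnit_det, det_diagonal]
    exact isUnit_iff_ne_zero.2 (Finset.prod_ne_zero_iff.2 fun i _ => hs i)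
  have hy : ∀ i, Y i i ≠ 0 := by
    have := (isUnit_iff_isUnit_det Y).1 hYu
    rw [hYd, det_diagonal] at this
    exact fun i => Finset.prod_ne_zero_iff.1 this.ne_zero i (Finset.mem_univ i)
  rw [hYd] at hMY
  have hij := congrFun (congrFun hMY i) j
  rw [mul_diagonal, diagonal_mul, transpose_apply] at hij
  constructor
  · intro h
    rw [h, zero_mul] at hij
    exact (mul_eq_zero.1 hij.symm).resolve_left (hy i)
  · intro h
    rw [h, mul_zero] at hij
    exact (mul_eq_zero.1 hij).resolve_right (hy j)

end Tridiagonal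

/-! ### Leonard pairs in matrix form. -/

section Basis

variable {K : Type*} [Field K] {d : ℕ}

/-- A Leonard pair of matrices, in terms of conjugating matrices. -/
theorem isLeonardPair_toLin'_iff (A B : Matrix (Fin (d + 1)) (Fin (d + 1)) K) :
    IsLeonardPair (toLin' A) (toLin' B) ↔
      (∃ R T : Matrix (Fin (d + 1)) (Fin (d + 1)) K, ∃ b, IsUnit R ∧ IsIrredTridiagonal T ∧
        A * R = R * T ∧ B * R = R * diagonal b) ∧
      (∃ R T : Matrix (Fin (d + 1)) (Fin (d + 1)) K, ∃ b, IsUnit R ∧ IsIrredTridiagonal T ∧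
        B * R = R * T ∧ A * R = R * diagonal b) := by
  have fwd : ∀ (v : Module.Basis (Fin (d + 1)) K (Fin (d + 1) → K))
      (A : Matrix (Fin (d + 1)) (Fin (d + 1)) K),
      A * (Pi.basisFun K _).toMatrix v =
        (Pi.basisFun K _).toMatrix v * LinearMap.toMatrix v v (toLin' A) := by
    intro v A
    rw [basis_toMatrix_mul_linearMap_toMatrix, ← linearMap_toMatrix_mul_basis_toMatrix
      (b' := Pi.basisFun K _), ← LinearMap.toMatrix'_toLin' A]
    simp [LinearMap.toMatrix_eq_toMatrix']
  have fwdu : ∀ (v : Module.Basis (Fin (d + 1)) K (Fin (d + 1) → K)),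
      IsUnit ((Pi.basisFun K _).toMatrix v) := by
    intro v
    have := (Pi.basisFun K (Fin (d + 1))).invertibleToMatrix v
    exact isUnit_of_invertible _
  -- The basis consists of the columns of `R`.
  have bwd : ∀ R : Matrix (Fin (d + 1)) (Fin (d + 1)) K, IsUnit R →
      ∃ v : Module.Basis (Fin (d + 1)) K (Fin (d + 1) → K), ∀ A T, A * R = R * T →
        LinearMap.toMatrix v v (toLin' A) = T := by
    intro R hR
    have := hR.invertible
    let v := (Pi.basisFun K (Fin (d + 1))).map (toLin'OfInv (invOf_mul_self R) (mul_invOf_self R))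
    have hv : (Pi.basisFun K _).toMatrix v = R := by
      ext i j
      simp [v, Module.Basis.toMatrix_apply]
    refine ⟨v, fun A T h => ?_⟩
    have h1 := fwd v A
    rw [hv, h] at h1
    exact (hR.mul_left_cancel h1).symm
  constructor
  · rintro ⟨d', ⟨v, hv1, hv2⟩, ⟨w, hw1, hw2⟩⟩
    obtain rfl : d = d' := by
      have := Module.finrank_eq_card_basis v
      simp at this
      omega
    refine ⟨⟨_, _, fun i => LinearMap.toMatrix v v (toLin' B) i i, fwdu v, hv1, fwd v A, ?_⟩,
      ⟨_, _, fun i => LinearMap.toMatrix w w (toLin' A) i i, fwdu w, hw1, fwd w B, ?_⟩⟩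
    · rw [fwd v B]
      exact congrArg _ hv2.diagonal_diag.symm
    · rw [fwd w A]
      exact congrArg _ hw2.diagonal_diag.symm
  · rintro ⟨⟨R, T, b, hR, hT, h1, h2⟩, ⟨R', T', b', hR', hT', h1', h2'⟩⟩
    obtain ⟨v, hv⟩ := bwd R hR
    obtain ⟨w, hw⟩ := bwd R' hR'
    refine ⟨d, ⟨v, ?_, ?_⟩, ⟨w, ?_, ?_⟩⟩
    · rwa [hv A T h1]
    · rw [hv B _ h2]
      exact isDiag_diagonal b
    · rwa [hw B _ h1']
    · rw [hw A _ h2']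
      exact isDiag_diagonal b'

end Basis

/-! ### Primitive idempotents and Leonard systems. -/

section Idempotents

variable {K : Type*} [Field K] {d : ℕ}

/-- The Lagrange basis polynomial takes the values `0` and `1` on the eigenvalues. -/
theorem primitiveIdempotent_eq {A P : Matrix (Fin (d + 1)) (Fin (d + 1)) K}
    {a : Fin (d + 1) → K} (ha : Function.Injective a) (hP : IsUnit P)
    (h : A * P = P * diagonal a) (i : Fin (d + 1)) :
    primitiveIdempotent A a i = P * diagonal (Pi.single i 1) * P⁻¹ := by
  rw [primitiveIdempotent, aeval_eq_of_mul_eq hP h]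
  congr 3
  ext j
  rcases eq_or_ne j i with rfl | hij
  · rw [Lagrange.eval_basis_self ha.injOn (Finset.mem_univ _), Pi.single_eq_same]
  · rw [Lagrange.eval_basis_of_ne hij.symm (Finset.mem_univ _), Pi.single_eq_of_ne hij]

theorem primitiveIdempotent_ne_zero {A P : Matrix (Fin (d + 1)) (Fin (d + 1)) K}
    {a : Fin (d + 1) → K} (ha : Function.Injective a) (hP : IsUnit P)
    (h : A * P = P * diagonal a) (i : Fin (d + 1)) : primitiveIdempotent A a i ≠ 0 := by
  rw [primitiveIdempotent_eq ha hP h]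
  intro h0
  have hdet := (isUnit_iff_isUnit_det P).1 hP
  have h1 := congrArg (fun Y => P⁻¹ * Y * P) h0
  simp only [mul_zero, zero_mul] at h1
  rw [mul_assoc P, nonsing_inv_mul_cancel_left _ _ hdet, nonsing_inv_mul_cancel_right _ _ hdet] at h1
  have := congrFun (congrFun h1 i) i
  simp at this

theorem mul_primitiveIdempotent {A P : Matrix (Fin (d + 1)) (Fin (d + 1)) K}
    {a : Fin (d + 1) → K} (ha : Function.Injective a) (hP : IsUnit P)
    (h : A * P = P * diagonal a) (i : Fin (d + 1)) :
    A * primitiveIdempotent A a i = a i • primitiveIdempotent A a i := by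
  rw [primitiveIdempotent_eq ha hP h, ← mul_assoc, ← mul_assoc, h, mul_assoc P,
    diagonal_mul_diagonal, ← Matrix.smul_mul, ← Matrix.mul_smul, ← diagonal_smul]
  congr 3
  ext j
  rcases eq_or_ne j i with rfl | hij
  · simp
  · simp [Pi.single_eq_of_ne hij]

/-- The idempotents are nonzero, so the scalar picked by `Classical.epsilon` is forced. -/
theorem eigenvalueSeq_primitiveIdempotent {A P : Matrix (Fin (d + 1)) (Fin (d + 1)) K}
    {a : Fin (d + 1) → K} (ha : Function.Injective a) (hP : IsUnit P)
    (h : A * P = P * diagonal a) : eigenvalueSeq A (primitiveIdempotent A a) = a := by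
  ext i
  have h1 := mul_primitiveIdempotent ha hP h i
  have h2 : A * primitiveIdempotent A a i =
      eigenvalueSeq A (primitiveIdempotent A a) i • primitiveIdempotent A a i :=
    Classical.epsilon_spec (p := fun t : K =>
      A * primitiveIdempotent A a i = t • primitiveIdempotent A a i) ⟨_, h1⟩
  exact smul_left_injective K (primitiveIdempotent_ne_zero ha hP h i) (h2.symm.trans h1)

theorem isEigenvalueOrdering {A P : Matrix (Fin (d + 1)) (Fin (d + 1)) K}
    {a : Fin (d + 1) → K} (ha : Function.Injective a) (hP : IsUnit P)
    (h : A * P = P * diagonal a) : IsEigenvalueOrdering A a := by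
  refine ⟨ha, fun i => ?_⟩
  refine Module.End.hasEigenvalue_of_hasEigenvector (x := P *ᵥ Pi.single i 1) ⟨?_, ?_⟩
  · rw [Module.End.mem_eigenspace_iff, toLin'_apply, mulVec_mulVec, h, ← mulVec_mulVec,
      diagonal_mulVec_single, mul_one, ← mulVec_smul]
    congr 1
    ext j
    simp [Pi.single_apply]
  · intro h0
    have h1 := mulVec_injective_of_isUnit hP (h0.trans (mulVec_zero P).symm)
    simpa using congrFun h1 i

/-- In the eigenbasis the product keeps only the `(i, j)` entry of `P⁻¹ * B * P`. This turns the
Leonard system axioms into tridiagonality. -/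
theorem conj_idempotents_eq_zero_iff {P : Matrix (Fin (d + 1)) (Fin (d + 1)) K} (hP : IsUnit P)
    (B : Matrix (Fin (d + 1)) (Fin (d + 1)) K) (i j : Fin (d + 1)) :
    P * diagonal (Pi.single i 1) * P⁻¹ * B * (P * diagonal (Pi.single j 1) * P⁻¹) = 0 ↔
      (P⁻¹ * B * P) i j = 0 := by
  have hdet := (isUnit_iff_isUnit_det P).1 hP
  have key : P * diagonal (Pi.single i 1) * P⁻¹ * B * (P * diagonal (Pi.single j 1) * P⁻¹) =
      P * (diagonal (Pi.single i 1) * (P⁻¹ * B * P) * diagonal (Pi.single j 1)) * P⁻¹ := by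
    simp only [mul_assoc]
  rw [key]
  constructor
  · intro h0
    have h1 := congrArg (fun Y => P⁻¹ * Y * P) h0
    simp only [mul_zero, zero_mul] at h1
    rw [mul_assoc P, nonsing_inv_mul_cancel_left _ _ hdet,
      nonsing_inv_mul_cancel_right _ _ hdet] at h1
    have := congrFun (congrFun h1 i) j
    rw [mul_diagonal, diagonal_mul] at this
    simpa using this
  · intro h0
    have : diagonal (Pi.single i 1) * (P⁻¹ * B * P) * diagonal (Pi.single j 1) = 0 := by
      ext k l
      rw [mul_diagonal, diagonal_mul]
      rcases eq_or_ne k i with rfl | hk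
      · rcases eq_or_ne l j with rfl | hl
        · simp [h0]
        · simp [Pi.single_eq_of_ne hl]
      · simp [Pi.single_eq_of_ne hk]
    rw [this, mul_zero, zero_mul]

theorem isLeonardSystem_of_isIrredTridiagonal {A B P Q : Matrix (Fin (d + 1)) (Fin (d + 1)) K}
    {a b : Fin (d + 1) → K} (ha : Function.Injective a) (hb : Function.Injective b)
    (hP : IsUnit P) (hQ : IsUnit Q) (hA : A * P = P * diagonal a) (hB : B * Q = Q * diagonal b)
    (hM : IsIrredTridiagonal (P⁻¹ * B * P)) (hN : IsIrredTridiagonal (Q⁻¹ * A * Q)) :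
    IsLeonardSystem A (primitiveIdempotent A a) B (primitiveIdempotent B b) where
  multiplicityFree := ⟨a, isEigenvalueOrdering ha hP hA⟩
  multiplicityFree_dual := ⟨b, isEigenvalueOrdering hb hQ hB⟩
  idempotents := ⟨a, isEigenvalueOrdering ha hP hA, fun _ => rfl⟩
  idempotents_dual := ⟨b, isEigenvalueOrdering hb hQ hB, fun _ => rfl⟩
  dual_eq_zero i j hij := by
    rw [primitiveIdempotent_eq ha hP hA, primitiveIdempotent_eq ha hP hA,
      conj_idempotents_eq_zero_iff hP]
    exact hM.1 i j hij
  dual_ne_zero i j hij := by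
    rw [primitiveIdempotent_eq ha hP hA, primitiveIdempotent_eq ha hP hA, Ne,
      conj_idempotents_eq_zero_iff hP]
    exact hM.2 i j hij
  eq_zero i j hij := by
    rw [primitiveIdempotent_eq hb hQ hB, primitiveIdempotent_eq hb hQ hB,
      conj_idempotents_eq_zero_iff hQ]
    exact hN.1 i j hij
  ne_zero i j hij := by
    rw [primitiveIdempotent_eq hb hQ hB, primitiveIdempotent_eq hb hQ hB, Ne,
      conj_idempotents_eq_zero_iff hQ]
    exact hN.2 i j hij

theorem trace_mul_conj_single (Y Q : Matrix (Fin (d + 1)) (Fin (d + 1)) K) (i : Fin (d + 1)) :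
    trace (Y * (Q * diagonal (Pi.single i 1) * Q⁻¹)) = (Q⁻¹ * Y * Q) i i := by
  rw [← mul_assoc, ← mul_assoc, trace_mul_comm, ← mul_assoc, ← mul_assoc, trace,
    Finset.sum_eq_single i _ (by simp), diag_apply, mul_diagonal, Pi.single_eq_same, mul_one]
  intro j _ hj
  rw [diag_apply, mul_diagonal, Pi.single_eq_of_ne hj, mul_zero]

end Idempotents

/-! ### Bidiagonal matrices and the polynomials `tau`, `eta`. -/

section Bidiagonal

variable {K : Type*} [Field K] {d : ℕ}

theorem upperBidiagonal_diag (a : Fin (d + 1) → K) (b : Fin d → K) (i : Fin (d + 1)) :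
    upperBidiagonal a b i i = a i := by
  simp [upperBidiagonal]

theorem upperBidiagonal_castSucc_succ (a : Fin (d + 1) → K) (b : Fin d → K) (k : Fin d) :
    upperBidiagonal a b k.castSucc k.succ = b k := by
  simp [upperBidiagonal, Fin.ext_iff]

theorem upperBidiagonal_eq_zero (a : Fin (d + 1) → K) (b : Fin d → K) {i j : Fin (d + 1)}
    (h1 : i ≠ j) (h2 : (i : ℕ) + 1 ≠ j) : upperBidiagonal a b i j = 0 := by
  simp [upperBidiagonal, h1, h2.symm]

theorem lowerBidiagonal_diag (a : Fin (d + 1) → K) (i : Fin (d + 1)) :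
    lowerBidiagonal a i i = a i := by
  simp [lowerBidiagonal]

theorem lowerBidiagonal_apply_of_succ (a : Fin (d + 1) → K) {i j : Fin (d + 1)}
    (h : (j : ℕ) + 1 = i) : lowerBidiagonal a i j = 1 := by
  have : i ≠ j := fun e => by rw [e] at h; omega
  simp [lowerBidiagonal, this, h]

theorem lowerBidiagonal_eq_zero (a : Fin (d + 1) → K) {i j : Fin (d + 1)}
    (h1 : i ≠ j) (h2 : (j : ℕ) + 1 ≠ i) : lowerBidiagonal a i j = 0 := by
  simp [lowerBidiagonal, h1, h2.symm]

theorem upperBidiagonal_isUpperTriangular (a : Fin (d + 1) → K) (b : Fin d → K) :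
    (upperBidiagonal a b).IsUpperTriangular := fun i j h => by
  have h' : (j : ℕ) < i := h
  exact upperBidiagonal_eq_zero a b (fun e => by rw [e] at h'; omega) (by omega)

theorem lowerBidiagonal_eq_zero_of_lt (a : Fin (d + 1) → K) (i j : Fin (d + 1)) (h : i < j) :
    lowerBidiagonal a i j = 0 := by
  have h' : (i : ℕ) < j := h
  exact lowerBidiagonal_eq_zero a h.ne (by omega)

theorem upperBidiagonal_mul_apply (a : Fin (d + 1) → K) (b : Fin d → K)
    (Y : Matrix (Fin (d + 1)) (Fin (d + 1)) K) (k : Fin d) (j : Fin (d + 1)) :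
    (upperBidiagonal a b * Y) k.castSucc j = a k.castSucc * Y k.castSucc j + b k * Y k.succ j := by
  rw [mul_apply, Finset.sum_eq_add k.castSucc k.succ (Fin.castSucc_lt_succ).ne _ (by simp) (by simp),
    upperBidiagonal_diag, upperBidiagonal_castSucc_succ]
  rintro l - ⟨h1, h2⟩
  rw [upperBidiagonal_eq_zero a b h1.symm (fun e => h2 (Fin.ext (by simp [← e]))), zero_mul]

theorem mul_upperBidiagonal_apply (a : Fin (d + 1) → K) (b : Fin d → K)
    (Y : Matrix (Fin (d + 1)) (Fin (d + 1)) K) (i : Fin (d + 1)) (k : Fin d) :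
    (Y * upperBidiagonal a b) i k.succ = Y i k.castSucc * b k + Y i k.succ * a k.succ := by
  rw [mul_apply, Finset.sum_eq_add k.castSucc k.succ (Fin.castSucc_lt_succ).ne _ (by simp) (by simp),
    upperBidiagonal_diag, upperBidiagonal_castSucc_succ]
  rintro l - ⟨h1, h2⟩
  rw [upperBidiagonal_eq_zero a b h2 (fun e => h1 (Fin.ext (by simpa using e))), mul_zero]

theorem mul_lowerBidiagonal_apply (a : Fin (d + 1) → K)
    (Y : Matrix (Fin (d + 1)) (Fin (d + 1)) K) (i : Fin (d + 1)) (k : Fin d) :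
    (Y * lowerBidiagonal a) i k.castSucc = Y i k.castSucc * a k.castSucc + Y i k.succ := by
  rw [mul_apply, Finset.sum_eq_add k.castSucc k.succ (Fin.castSucc_lt_succ).ne _ (by simp) (by simp),
    lowerBidiagonal_diag, lowerBidiagonal_apply_of_succ a (by simp), mul_one]
  rintro l - ⟨h1, h2⟩
  rw [lowerBidiagonal_eq_zero a h1 (fun e => h2 (Fin.ext (by simp [← e]))), mul_zero]

theorem prod_filter_val_lt_succ {n : ℕ} {R : Type*} [CommMonoid R] (f : Fin n → R) (k : Fin n) :
    ∏ h ∈ Finset.univ.filter (fun h : Fin n => (h : ℕ) < (k : ℕ) + 1), f h =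
      (∏ h ∈ Finset.univ.filter (fun h : Fin n => (h : ℕ) < k), f h) * f k := by
  have : Finset.univ.filter (fun h : Fin n => (h : ℕ) < (k : ℕ) + 1) =
      insert k (Finset.univ.filter (fun h : Fin n => (h : ℕ) < k)) := by
    ext h
    simp only [Finset.mem_filter, Finset.mem_univ, true_and, Finset.mem_insert, Fin.ext_iff]
    omega
  rw [this, Finset.prod_insert (by simp), mul_comm]

/-- Each factor shifts a basis vector: `(A - a_k) e_k = e_{k+1}`, so `τ_k(A) e_0 = e_k`. -/
theorem aeval_tau_apply_zero (a : Fin (d + 1) → K) (k i : Fin (d + 1)) :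
    aeval (lowerBidiagonal a) (tau a k) i 0 = (1 : Matrix (Fin (d + 1)) (Fin (d + 1)) K) i k := by
  induction k using Fin.induction generalizing i with
  | zero => simp [tau]
  | succ k ih =>
    have h : tau a (k.succ : ℕ) = (X - C (a k.castSucc)) * tau a (k.castSucc : ℕ) := by
      rw [mul_comm]
      exact prod_filter_val_lt_succ (fun h => X - C (a h)) k.castSucc
    rw [h, map_mul, map_sub, aeval_X, aeval_C, sub_mul, ← Algebra.smul_def, Matrix.sub_apply,
      Matrix.smul_apply, mul_apply]
    simp only [ih]
    rw [← mul_apply, mul_one, one_apply, one_apply]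
    by_cases h1 : i = k.castSucc
    · subst h1
      simp [lowerBidiagonal_diag, Fin.ext_iff]
    · by_cases h2 : i = k.succ
      · subst h2
        simp [lowerBidiagonal_apply_of_succ a, Fin.ext_iff]
      · rw [lowerBidiagonal_eq_zero a h1 (fun e => h2 (Fin.ext (by simp [← e])))]
        simp [h1, h2]

/-- The dual shift on row vectors: multiplying `e_jᵀ` by `A - a_j` gives `e_{j-1}ᵀ`, starting from
the last row. -/
theorem aeval_eta_last_apply (a : Fin (d + 1) → K) (k j : Fin (d + 1)) :
    aeval (lowerBidiagonal a) (eta a k) (Fin.last d) j =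
      (1 : Matrix (Fin (d + 1)) (Fin (d + 1)) K) k.rev j := by
  induction k using Fin.induction generalizing j with
  | zero => rw [Fin.rev_zero]; simp [eta]
  | succ k ih =>
    have h : eta a (k.succ : ℕ) = eta a (k.castSucc : ℕ) * (X - C (a k.castSucc.rev)) :=
      prod_filter_val_lt_succ (fun h => X - C (a h.rev)) k.castSucc
    rw [h, map_mul, map_sub, aeval_X, aeval_C, mul_sub, ← Algebra.commutes, ← Algebra.smul_def,
      Matrix.sub_apply, Matrix.smul_apply, mul_apply]
    simp only [ih]
    rw [← mul_apply, one_mul, one_apply, one_apply, Fin.rev_castSucc, Fin.rev_succ]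
    by_cases h1 : k.rev.succ = j
    · subst h1
      simp [lowerBidiagonal_diag, Fin.ext_iff]
    · by_cases h2 : k.rev.castSucc = j
      · subst h2
        simp [lowerBidiagonal_apply_of_succ a, Fin.ext_iff]
      · rw [lowerBidiagonal_eq_zero a h1
          (fun e => h2 (Fin.ext (by simp at e ⊢; omega)))]
        simp [h1, h2]

end Bidiagonal

/-! ### Conjugation of the bidiagonal pair into eigenbases. -/

section Conjugation

variable {K : Type*} [Field K] {d : ℕ}

theorem IsLowerUnitriangular.conj_upperBidiagonal_apply
    {P : Matrix (Fin (d + 1)) (Fin (d + 1)) K} (hP : IsLowerUnitriangular P)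
    (a : Fin (d + 1) → K) (b : Fin d → K) {i j : Fin (d + 1)} (hij : (i : ℕ) + 1 ≤ j) :
    (P⁻¹ * upperBidiagonal a b * P) i j = upperBidiagonal a b i j :=
  unitriangular_mul_hessenberg_mul hP.inv hP
    (fun i j h => upperBidiagonal_eq_zero a b (fun e => by rw [e] at h; omega) (by omega)) hij

theorem IsLowerUnitriangular.conj_lowerBidiagonal_apply
    {Q : Matrix (Fin (d + 1)) (Fin (d + 1)) K} (hQ : IsLowerUnitriangular Qᵀ)
    (a : Fin (d + 1) → K) {i j : Fin (d + 1)} (hij : (j : ℕ) + 1 ≤ i) :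
    (Q⁻¹ * lowerBidiagonal a * Q) i j = lowerBidiagonal a i j := by
  have h := unitriangular_mul_hessenberg_mul hQ hQ.inv (U := (lowerBidiagonal a)ᵀ)
    (fun i j h => lowerBidiagonal_eq_zero a (fun e => by rw [e] at h; omega) (by omega)) hij
  rw [← transpose_nonsing_inv, ← transpose_mul, ← transpose_mul, ← mul_assoc] at h
  exact h

theorem inv_mul_eq_of_mul_eq {A P D : Matrix (Fin (d + 1)) (Fin (d + 1)) K} (hP : IsUnit P)
    (h : A * P = P * D) : P⁻¹ * A = D * P⁻¹ := by
  have hdet := (isUnit_iff_isUnit_det P).1 hP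
  calc P⁻¹ * A = P⁻¹ * (A * P) * P⁻¹ := by
        rw [mul_assoc, mul_assoc, mul_nonsing_inv _ hdet, mul_one]
    _ = D * P⁻¹ := by rw [h, nonsing_inv_mul_cancel_left _ _ hdet]

theorem mul_eq_mul_conj {A P : Matrix (Fin (d + 1)) (Fin (d + 1)) K} (hP : IsUnit P) :
    A * P = P * (P⁻¹ * A * P) := by
  have hdet := (isUnit_iff_isUnit_det P).1 hP
  rw [mul_assoc, mul_nonsing_inv_cancel_left _ _ hdet]

theorem exists_perm_of_conj {A B Q R T : Matrix (Fin (d + 1)) (Fin (d + 1)) K}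
    {a b : Fin (d + 1) → K} (ha : Function.Injective a) (hQ : IsUnit Q) (hR : IsUnit R)
    (hBQ : B * Q = Q * diagonal a) (hBR : B * R = R * diagonal b) (hAR : A * R = R * T) :
    ∃ σ : Equiv.Perm (Fin (d + 1)), (∀ j, a (σ j) = b j) ∧
      ∀ i j, (Q⁻¹ * A * Q) (σ i) (σ j) = 0 ↔ T i j = 0 := by
  have hdet := (isUnit_iff_isUnit_det Q).1 hQ
  refine exists_perm_of_intertwine (C := Q⁻¹ * R) ha
    (((isUnit_nonsing_inv_iff).2 hQ).mul hR) ?_ ?_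
  · rw [← mul_assoc, ← inv_mul_eq_of_mul_eq hQ hBQ, mul_assoc, hBR, mul_assoc]
  · rw [mul_assoc _ Q, mul_nonsing_inv_cancel_left _ _ hdet, mul_assoc, hAR, mul_assoc]

/-! ### The equivalence, the split sequences and the switching element. -/

section Split

variable {θ θs : Fin (d + 1) → K} {φ : Fin d → K} {P Q : Matrix (Fin (d + 1)) (Fin (d + 1)) K}

theorem isIrredTridiagonal_of_isLeonardPair (hθ : Function.Injective θ)
    (hθs : Function.Injective θs) (hφ : ∀ k, φ k ≠ 0)
    (hP : IsLowerUnitriangular P) (hQ : IsLowerUnitriangular Qᵀ)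
    (hAP : lowerBidiagonal θ * P = P * diagonal θ)
    (hBQ : upperBidiagonal θs φ * Q = Q * diagonal θs)
    (h : IsLeonardPair (toLin' (lowerBidiagonal θ)) (toLin' (upperBidiagonal θs φ))) :
    IsIrredTridiagonal (P⁻¹ * upperBidiagonal θs φ * P) ∧
      IsIrredTridiagonal (Q⁻¹ * lowerBidiagonal θ * Q) := by
  obtain ⟨⟨R, T, b, hR, hT, h1, h2⟩, ⟨R', T', b', hR', hT', h1', h2'⟩⟩ :=
    (isLeonardPair_toLin'_iff _ _).1 h
  constructor
  · obtain ⟨σ, -, hσ⟩ := exists_perm_of_conj hθ hP.isUnit hR' hAP h2' h1'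
    -- The known nonzero entries lie on the superdiagonal, whereas `isIrredTridiagonal_of_perm` asks
    -- for the subdiagonal.
    rw [← transpose_transpose (P⁻¹ * upperBidiagonal θs φ * P)]
    refine (isIrredTridiagonal_of_perm hT'.transpose σ (fun i j => hσ j i) ?_).transpose
    intro i j hij
    rw [transpose_apply, hP.conj_upperBidiagonal_apply _ _ hij.le]
    obtain ⟨k, rfl⟩ : ∃ k : Fin d, i = k.castSucc := ⟨⟨i, by omega⟩, rfl⟩
    obtain rfl : j = k.succ := Fin.ext (by simp [← hij])
    rw [upperBidiagonal_castSucc_succ]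
    exact hφ k
  · obtain ⟨σ, -, hσ⟩ := exists_perm_of_conj hθs ((isUnit_transpose Q).1 hQ.isUnit) hR hBQ h2 h1
    refine isIrredTridiagonal_of_perm hT σ hσ ?_
    intro i j hij
    rw [hQ.conj_lowerBidiagonal_apply _ hij.le, lowerBidiagonal_apply_of_succ _ hij]
    exact one_ne_zero

theorem isLeonardPair_of_isIrredTridiagonal {A B : Matrix (Fin (d + 1)) (Fin (d + 1)) K}
    (hP : IsUnit P) (hQ : IsUnit Q) (hAP : A * P = P * diagonal θ) (hBQ : B * Q = Q * diagonal θs)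
    (hM : IsIrredTridiagonal (P⁻¹ * B * P)) (hN : IsIrredTridiagonal (Q⁻¹ * A * Q)) :
    IsLeonardPair (toLin' A) (toLin' B) :=
  (isLeonardPair_toLin'_iff _ _).2
    ⟨⟨Q, _, θs, hQ, hN, mul_eq_mul_conj hQ, hBQ⟩, ⟨P, _, θ, hP, hM, mul_eq_mul_conj hP, hAP⟩⟩

/-- The existence of a switching matrix makes both `P⁻¹ A^* P` and `Q⁻¹ A Q` irreducible
tridiagonal. -/
theorem isIrredTridiagonal_of_switching (hθ : Function.Injective θ)
    (hθs : Function.Injective θs) (hφ : ∀ k, φ k ≠ 0)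
    (hP : IsLowerUnitriangular P) (hQ : IsLowerUnitriangular Qᵀ)
    (hAP : lowerBidiagonal θ * P = P * diagonal θ)
    (hBQ : upperBidiagonal θs φ * Q = Q * diagonal θs)
    {X : Matrix (Fin (d + 1)) (Fin (d + 1)) K} {ψ : Fin d → K} (hX : IsUnit X)
    (hAX : lowerBidiagonal θ * X = X * lowerBidiagonal θ)
    (hBX : upperBidiagonal θs φ * X = X * upperBidiagonal (fun i => θs i.rev) ψ) :
    IsIrredTridiagonal (P⁻¹ * upperBidiagonal θs φ * P) ∧
      IsIrredTridiagonal (Q⁻¹ * lowerBidiagonal θ * Q) := by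
  have hQu : IsUnit Q := (isUnit_transpose Q).1 hQ.isUnit
  have hQd := (isUnit_iff_isUnit_det Q).1 hQu
  have hPd := (isUnit_iff_isUnit_det P).1 hP.isUnit
  have hN : IsIrredTridiagonal (Q⁻¹ * lowerBidiagonal θ * Q) := by
    obtain ⟨S, hS, hBS⟩ := exists_diagonalizer_upper
      (upperBidiagonal_isUpperTriangular (fun i => θs i.rev) ψ)
      (hθs.comp Fin.rev_injective) (upperBidiagonal_diag _ _)
    have hSu : IsUnit S := (isUnit_transpose S).1 hS.isUnit
    -- `X * S` diagonalizes `A*` in reversed order, and `X` drops out of the conjugate of `A`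
    -- because it commutes with `A`.
    obtain ⟨σ, hσ, hpat⟩ := exists_perm_of_conj (A := lowerBidiagonal θ) (R := X * S)
      (b := fun i => θs i.rev) (T := S⁻¹ * lowerBidiagonal θ * S) hθs hQu (hX.mul hSu) hBQ
      (by rw [← mul_assoc, hBX, mul_assoc, mul_assoc]; exact congrArg _ hBS)
      (by rw [← mul_assoc, hAX, mul_assoc, mul_eq_mul_conj hSu, mul_assoc X])
    have hrev : ∀ j, σ j = j.rev := fun j => hθs (hσ j)
    have hpat' : ∀ i j, (Q⁻¹ * lowerBidiagonal θ * Q) i j = 0 ↔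
        (S⁻¹ * lowerBidiagonal θ * S) i.rev j.rev = 0 := fun i j => by
      have := hpat i.rev j.rev
      rwa [hrev, hrev, Fin.rev_rev, Fin.rev_rev] at this
    constructor
    · rintro i j (hij | hij)
      · have h : (j.rev : ℕ) + 1 < i.rev := by simp only [Fin.val_rev]; omega
        rw [hpat', hS.conj_lowerBidiagonal_apply _ h.le]
        exact lowerBidiagonal_eq_zero _ (fun e => by rw [e] at h; omega) h.ne
      · rw [hQ.conj_lowerBidiagonal_apply _ hij.le]
        exact lowerBidiagonal_eq_zero _ (fun e => by rw [e] at hij; omega) hij.ne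
    · rintro i j (hij | hij)
      · have h : (j.rev : ℕ) + 1 = i.rev := by simp only [Fin.val_rev]; omega
        rw [Ne, hpat', hS.conj_lowerBidiagonal_apply _ h.le, lowerBidiagonal_apply_of_succ _ h]
        exact one_ne_zero
      · rw [hQ.conj_lowerBidiagonal_apply _ hij.le, lowerBidiagonal_apply_of_succ _ hij]
        exact one_ne_zero
  refine ⟨?_, hN⟩
  -- `P⁻¹ * Q` is the transition matrix between the two eigenbases.
  have hsymm := symm_zero_of_intertwine (M := P⁻¹ * upperBidiagonal θs φ * P) (W := P⁻¹ * Q)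
    (b := θs) hθ hN (((isUnit_nonsing_inv_iff).2 hP.isUnit).mul hQu)
    (by rw [mul_assoc _ P, mul_nonsing_inv_cancel_left _ _ hPd, mul_assoc, hBQ, mul_assoc])
    (by rw [← mul_assoc, ← inv_mul_eq_of_mul_eq hP.isUnit hAP, mul_assoc P⁻¹ Q,
          ← mul_eq_mul_conj hQu, mul_assoc])
  have h0 : ∀ i j : Fin (d + 1), (i : ℕ) + 1 < j →
      (P⁻¹ * upperBidiagonal θs φ * P) i j = 0 := fun i j hij => by
    rw [hP.conj_upperBidiagonal_apply _ _ hij.le]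
    exact upperBidiagonal_eq_zero _ _ (fun e => by rw [e] at hij; omega) hij.ne
  have h1 : ∀ i j : Fin (d + 1), (i : ℕ) + 1 = j →
      (P⁻¹ * upperBidiagonal θs φ * P) i j ≠ 0 := fun i j hij => by
    rw [hP.conj_upperBidiagonal_apply _ _ hij.le]
    obtain ⟨k, rfl⟩ : ∃ k : Fin d, i = k.castSucc := ⟨⟨i, by omega⟩, rfl⟩
    obtain rfl : j = k.succ := Fin.ext (by simp [← hij])
    rw [upperBidiagonal_castSucc_succ]
    exact hφ k
  constructor
  · rintro i j (hij | hij)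
    · exact h0 i j hij
    · exact (hsymm i j).2 (h0 j i hij)
  · rintro i j (hij | hij)
    · exact h1 i j hij
    · exact fun e => h1 j i hij ((hsymm i j).1 e)

/-- Construction of the switching matrix as the polynomial in `A` sending the first standard
basis vector to the eigenvector of `A^*` for `θ^*_d`. -/
theorem exists_switching (hP : IsLowerUnitriangular P) (hQ : IsLowerUnitriangular Qᵀ)
    (hAP : lowerBidiagonal θ * P = P * diagonal θ)
    (hBQ : upperBidiagonal θs φ * Q = Q * diagonal θs)
    (hM : IsIrredTridiagonal (P⁻¹ * upperBidiagonal θs φ * P))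
    (hN : IsIrredTridiagonal (Q⁻¹ * lowerBidiagonal θ * Q)) :
    ∃ (X : Matrix (Fin (d + 1)) (Fin (d + 1)) K) (ψ : Fin d → K), IsUnit X ∧ (∀ k, ψ k ≠ 0) ∧
      lowerBidiagonal θ * X = X * lowerBidiagonal θ ∧
      upperBidiagonal θs φ * X = X * upperBidiagonal (fun i => θs i.rev) ψ := by
  set A := lowerBidiagonal θ with hA
  set B := upperBidiagonal θs φ with hB
  have hQu : IsUnit Q := (isUnit_transpose Q).1 hQ.isUnit
  -- Since `τ_i(A) e_0 = e_i`, these coefficients make `p(A) e_0` the last column of `Q`.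
  let p : K[X] := ∑ i : Fin (d + 1), C (Q i (Fin.last d)) * tau θ i
  let X := aeval A p
  have hX0 : ∀ i, X i 0 = Q i (Fin.last d) := by
    intro i
    simp only [X, p, map_sum, map_mul, aeval_C, ← Algebra.smul_def, Matrix.sum_apply,
      Matrix.smul_apply, hA, aeval_tau_apply_zero, one_apply]
    simp
  have hAX : A * X = X * A := by
    have : aeval A (Polynomial.X * p) = aeval A (p * Polynomial.X) := by rw [mul_comm]
    rw [map_mul, map_mul, aeval_X] at this
    exact this
  -- the eigenvectors of `A^*` in reversed order
  let R := Q.submatrix id Fin.revPerm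
  have hRu : IsUnit R := (isUnit_submatrix_equiv (Equiv.refl _) Fin.revPerm).2 hQu
  have hRd := (isUnit_iff_isUnit_det R).1 hRu
  have hBR : B * R = R * diagonal (fun i => θs i.rev) := by
    ext i j
    have := congrFun (congrFun hBQ i) j.rev
    rw [mul_diagonal] at this ⊢
    exact this
  have hRi : R⁻¹ = Q⁻¹.submatrix Fin.revPerm id := inv_submatrix_equiv Q (Equiv.refl _) Fin.revPerm
  have hNR : ∀ i j, (R⁻¹ * A * R) i j = (Q⁻¹ * A * Q) i.rev j.rev := by
    intro i j
    rw [hRi]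
    rfl
  let U := R⁻¹ * X
  have hXU : X = R * U := (mul_nonsing_inv_cancel_left _ _ hRd).symm
  have hUA : U * A = R⁻¹ * A * R * U := by
    rw [mul_assoc _ R, ← hXU, mul_assoc, mul_assoc, hAX]
  -- Column `0` of `U` is `e_0`, and column `k + 1` is `R⁻¹ A R - θ_k` applied to column `k`; a
  -- tridiagonal matrix extends the support by one place, with nonzero new entry.
  have hU : ∀ j, (∀ i, j < i → U i j = 0) ∧ U j j ≠ 0 := by
    intro j
    induction j using Fin.induction with
    | zero =>
      have h0 : ∀ i, U i 0 = (1 : Matrix (Fin (d + 1)) (Fin (d + 1)) K) i 0 := by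
        intro i
        rw [← nonsing_inv_mul _ hRd]
        change (R⁻¹ * X) i 0 = _
        rw [mul_apply, mul_apply]
        refine Finset.sum_congr rfl fun k _ => ?_
        rw [hX0]
        simp [R]
      exact ⟨fun i hi => by rw [h0, one_apply_ne hi.ne'], by rw [h0, one_apply_eq]; exact one_ne_zero⟩
    | succ k ih =>
      obtain ⟨ih0, ih1⟩ := ih
      have hrec : ∀ i, k.castSucc < i →
          U i k.succ = (R⁻¹ * A * R) i k.castSucc * U k.castSucc k.castSucc := by
        intro i hi
        have h1 := congrFun (congrFun hUA i) k.castSucc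
        rw [hA, mul_lowerBidiagonal_apply, ← hA, ih0 i hi, zero_mul, zero_add] at h1
        rw [h1, mul_apply, Finset.sum_eq_single k.castSucc _ (by simp)]
        intro l _ hl
        rcases lt_or_gt_of_ne hl with h | h
        · rw [hNR, hN.1, zero_mul]
          have h' : (l : ℕ) < k := h
          have hi' : (k : ℕ) < i := hi
          left
          simp only [Fin.val_rev]
          omega
        · rw [ih0 l h, mul_zero]
      constructor
      · intro i hi
        have hi' : (k : ℕ) + 1 < i := hi
        rw [hrec i (Fin.castSucc_lt_succ.trans hi), hNR, hN.1, zero_mul]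
        left
        simp only [Fin.val_rev, Fin.val_castSucc]
        omega
      · rw [hrec _ Fin.castSucc_lt_succ, hNR]
        refine mul_ne_zero (hN.2 _ _ ?_) ih1
        left
        simp only [Fin.val_rev, Fin.val_castSucc, Fin.val_succ]
        omega
  have hUt : U.IsUpperTriangular := fun i j h => (hU j).1 i h
  have hUu : IsUnit U := by
    rw [isUnit_iff_isUnit_det, det_of_isUpperTriangular hUt]
    exact isUnit_iff_ne_zero.2 (Finset.prod_ne_zero_iff.2 fun i _ => (hU i).2)
  have hUd := (isUnit_iff_isUnit_det U).1 hUu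
  have hXu : IsUnit X := by rw [hXU]; exact hRu.mul hUu
  have hXd := (isUnit_iff_isUnit_det X).1 hXu
  have hBX1 : X⁻¹ * B * X = U⁻¹ * diagonal (fun i => θs i.rev) * U := by
    rw [mul_assoc, hXU, ← mul_assoc B, hBR, Matrix.mul_inv_rev, mul_assoc U⁻¹, mul_assoc R,
      nonsing_inv_mul_cancel_left _ _ hRd, mul_assoc]
  -- the eigenvalues of the polynomial `X` in `A`
  have hPd := (isUnit_iff_isUnit_det P).1 hP.isUnit
  let x : Fin (d + 1) → K := fun i => p.eval (θ i)
  have hXP : X = P * diagonal x * P⁻¹ := aeval_eq_of_mul_eq hP.isUnit hAP p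
  have hx : ∀ i, x i ≠ 0 := by
    have h := hXd
    rw [hXP, det_mul, det_mul, mul_comm, ← mul_assoc, ← det_mul, nonsing_inv_mul _ hPd, det_one,
      one_mul, det_diagonal] at h
    exact fun i => Finset.prod_ne_zero_iff.1 h.ne_zero i (Finset.mem_univ i)
  -- `V` is `X⁻¹ A* X` in the eigenbasis of `A`; the diagonal rescaling preserves the tridiagonal
  -- pattern.
  let V := diagonal (fun i => (x i)⁻¹) * (P⁻¹ * B * P) * diagonal x
  have hV : ∀ i j, V i j = (x i)⁻¹ * (P⁻¹ * B * P) i j * x j := fun i j => by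
    change (diagonal (fun i => (x i)⁻¹) * (P⁻¹ * B * P) * diagonal x) i j = _
    rw [mul_diagonal, diagonal_mul]
  have hBX2 : X⁻¹ * B * X = P * V * P⁻¹ := by
    refine hXu.mul_left_cancel ?_
    have hxx : diagonal x * diagonal (fun i => (x i)⁻¹) = 1 := by
      rw [diagonal_mul_diagonal, ← diagonal_one]
      congr 1
      ext i
      exact mul_inv_cancel₀ (hx i)
    rw [← mul_eq_mul_conj hXu]
    have h1 : X * (P * V * P⁻¹) = P * (diagonal x * V) * P⁻¹ := by
      rw [hXP]
      simp only [mul_assoc]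
      rw [nonsing_inv_mul_cancel_left _ _ hPd]
    have h2 : diagonal x * V = P⁻¹ * B * P * diagonal x := by
      simp only [V, ← mul_assoc]
      rw [hxx, one_mul]
    rw [h1, h2, hXP]
    simp only [← mul_assoc]
    rw [mul_nonsing_inv _ hPd, one_mul]
  have hup : ∀ i j : Fin (d + 1), (i : ℕ) + 1 ≤ j → (X⁻¹ * B * X) i j = V i j := by
    intro i j hij
    rw [hBX2]
    refine unitriangular_mul_hessenberg_mul hP hP.inv (fun i j h => ?_) hij
    rw [hV, hM.1 i j (Or.inl h), mul_zero, zero_mul]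
  have hUit := isUpperTriangular_inv hUt hUu
  have hDt : (diagonal (fun i => θs i.rev) : Matrix (Fin (d + 1)) (Fin (d + 1)) K).IsUpperTriangular :=
    blockTriangular_diagonal _
  refine ⟨X, fun k => (X⁻¹ * B * X) k.castSucc k.succ, hXu, fun k => ?_, hAX, ?_⟩
  · dsimp only
    rw [hup _ _ (by simp), hV]
    exact mul_ne_zero (mul_ne_zero (inv_ne_zero (hx _)) (hM.2 _ _ (Or.inl (by simp)))) (hx _)
  · rw [mul_eq_mul_conj hXu]
    congr 1
    ext i j
    rcases lt_trichotomy i j with h | rfl | h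
    · have h' : (i : ℕ) < j := h
      by_cases hij : (i : ℕ) + 1 = j
      · obtain ⟨k, rfl⟩ : ∃ k : Fin d, i = k.castSucc := ⟨⟨i, by omega⟩, rfl⟩
        obtain rfl : j = k.succ := Fin.ext (by simp [← hij])
        rw [upperBidiagonal_castSucc_succ]
      · rw [upperBidiagonal_eq_zero _ _ h.ne hij, hup _ _ (by omega), hV,
          hM.1 _ _ (Or.inl (by omega)), mul_zero, zero_mul]
    · rw [upperBidiagonal_diag, hBX1, mul_apply_diag_of_upper (hUit.mul hDt) hUt,
        mul_apply_diag_of_upper hUit hDt, diagonal_apply_eq]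
      have h1 : U⁻¹ i i * U i i = 1 := by
        rw [← mul_apply_diag_of_upper hUit hUt, nonsing_inv_mul _ hUd, one_apply_eq]
      linear_combination θs i.rev * h1
    · rw [upperBidiagonal_isUpperTriangular _ _ h, hBX1]
      exact (hUit.mul hDt).mul hUt h

/-- The traces are the entries of row `0` of `Q⁻¹`. This row is a left eigenvector of `A*` for
`θ*_0`, whose two-term recurrence has the coefficients `φ`. -/
theorem firstSplitSeq_eq (hθ : Function.Injective θ)
    (hθs : Function.Injective θs) (hφ : ∀ k, φ k ≠ 0)
    (hP : IsUnit P) (hQ : IsLowerUnitriangular Qᵀ)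
    (hAP : lowerBidiagonal θ * P = P * diagonal θ)
    (hBQ : upperBidiagonal θs φ * Q = Q * diagonal θs) (k : Fin d) :
    firstSplitSeq (lowerBidiagonal θ) (primitiveIdempotent (lowerBidiagonal θ) θ)
      (upperBidiagonal θs φ) (primitiveIdempotent (upperBidiagonal θs φ) θs) k = φ k := by
  have hQu : IsUnit Q := (isUnit_transpose Q).1 hQ.isUnit
  have htr : ∀ k : Fin (d + 1), trace (aeval (lowerBidiagonal θ) (tau θ k) *
      primitiveIdempotent (upperBidiagonal θs φ) θs 0) = Q⁻¹ 0 k := by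
    intro k
    rw [primitiveIdempotent_eq hθs hQu hBQ, trace_mul_conj_single, mul_apply,
      Finset.sum_eq_single 0 _ (by simp)]
    · rw [show Q 0 0 = 1 from hQ.diag 0, mul_one, mul_apply]
      simp only [aeval_tau_apply_zero]
      rw [← mul_apply, mul_one]
    · intro i _ hi
      rw [show Q i 0 = 0 from hQ.eq_zero 0 i (Fin.pos_of_ne_zero hi), mul_zero]
  have hrec : ∀ k : Fin d, Q⁻¹ 0 k.castSucc * φ k = (θs 0 - θs k.succ) * Q⁻¹ 0 k.succ := by
    intro k
    have h := congrFun (congrFun (inv_mul_eq_of_mul_eq hQu hBQ) 0) k.succ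
    rw [mul_upperBidiagonal_apply, diagonal_mul] at h
    linear_combination h
  have hne : ∀ k : Fin (d + 1), Q⁻¹ 0 k ≠ 0 := by
    intro k
    induction k using Fin.induction with
    | zero =>
      have := hQ.inv.diag 0
      rw [← transpose_nonsing_inv, transpose_apply] at this
      rw [this]
      exact one_ne_zero
    | succ k ih =>
      intro h
      have := hrec k
      rw [h, mul_zero] at this
      exact mul_ne_zero ih (hφ k) this
  rw [firstSplitSeq, eigenvalueSeq_primitiveIdempotent hθs hQu hBQ,
    eigenvalueSeq_primitiveIdempotent hθ hP hAP]
  have h1 := htr k.succ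
  have h2 := htr k.castSucc
  rw [Fin.val_succ] at h1
  rw [Fin.val_castSucc] at h2
  rw [h1, h2, mul_div_assoc', ← hrec, mul_div_cancel_left₀ _ (hne _)]

/-- Transporting by `X`, which commutes with `A`, replaces `A*` by the reversed bidiagonal matrix.
The traces become the entries, read upwards, of its eigenvector for `θ*_0`, the last column of `S`.
-/
theorem secondSplitSeq_eq (hθ : Function.Injective θ)
    (hθs : Function.Injective θs) (hP : IsUnit P) (hQ : IsUnit Q)
    (hAP : lowerBidiagonal θ * P = P * diagonal θ)
    {B : Matrix (Fin (d + 1)) (Fin (d + 1)) K} (hBQ : B * Q = Q * diagonal θs)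
    {X : Matrix (Fin (d + 1)) (Fin (d + 1)) K} {ϕ : Fin d → K} (hX : IsUnit X)
    (hϕ : ∀ k, ϕ k ≠ 0)
    (hAX : lowerBidiagonal θ * X = X * lowerBidiagonal θ)
    (hBX : B * X = X * upperBidiagonal (fun i => θs i.rev) (fun k => ϕ k.rev)) (k : Fin d) :
    secondSplitSeq (lowerBidiagonal θ) (primitiveIdempotent (lowerBidiagonal θ) θ)
      B (primitiveIdempotent B θs) k = ϕ k := by
  obtain ⟨S, hS, hBS⟩ := exists_diagonalizer_upper
    (upperBidiagonal_isUpperTriangular (fun i => θs i.rev) (fun k => ϕ k.rev))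
    (hθs.comp Fin.rev_injective) (upperBidiagonal_diag _ _)
  have hSu : IsUnit S := (isUnit_transpose S).1 hS.isUnit
  -- the columns of `X * S` in reversed order are eigenvectors of `B`
  let R := (X * S).submatrix id Fin.revPerm
  have hRu : IsUnit R := (isUnit_submatrix_equiv (Equiv.refl _) Fin.revPerm).2 (hX.mul hSu)
  have hBR : B * R = R * diagonal θs := by
    have h : B * (X * S) = X * S * diagonal (fun i => θs i.rev) := by
      rw [← mul_assoc, hBX, mul_assoc, mul_assoc]
      exact congrArg _ hBS
    ext i j
    have := congrFun (congrFun h i) j.rev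
    rw [mul_diagonal, Fin.rev_rev] at this
    rw [mul_diagonal]
    exact this
  have hRi : R⁻¹ = (X * S)⁻¹.submatrix Fin.revPerm id :=
    inv_submatrix_equiv (X * S) (Equiv.refl _) Fin.revPerm
  have hXd := (isUnit_iff_isUnit_det X).1 hX
  have hlast : ∀ i, S⁻¹ (Fin.last d) i = (1 : Matrix (Fin (d + 1)) (Fin (d + 1)) K) (Fin.last d) i := by
    intro i
    have hSi := hS.inv
    rw [← transpose_nonsing_inv] at hSi
    rcases (Fin.le_last i).eq_or_lt with rfl | h
    · rw [one_apply_eq]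
      exact hSi.diag _
    · rw [one_apply_ne h.ne']
      exact hSi.eq_zero i _ h
  have htr : ∀ k : Fin (d + 1), trace (aeval (lowerBidiagonal θ) (eta θ k) *
      primitiveIdempotent B θs 0) = S k.rev (Fin.last d) := by
    intro k
    rw [primitiveIdempotent_eq hθs hRu hBR, trace_mul_conj_single]
    set Y := aeval (lowerBidiagonal θ) (eta θ k) with hY
    have hYX : X⁻¹ * Y * X = Y := by
      have hc : Commute X Y := by
        have h : Commute X (lowerBidiagonal θ) := hAX.symm
        rw [hY, aeval_eq_sum_range]
        exact Commute.sum_right _ _ _ fun i _ => (h.pow_right i).smul_right _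
      rw [mul_assoc, ← hc.eq, nonsing_inv_mul_cancel_left _ _ hXd]
    have h1 : (R⁻¹ * Y * R) 0 0 = ((X * S)⁻¹ * Y * (X * S)) (Fin.last d) (Fin.last d) := by
      rw [hRi, ← Fin.rev_zero]
      rfl
    have h2 : (X * S)⁻¹ * Y * (X * S) = S⁻¹ * (Y * S) := by
      nth_rewrite 2 [← hYX]
      rw [Matrix.mul_inv_rev]
      simp only [mul_assoc]
    rw [h1, h2, mul_apply]
    simp only [hlast]
    rw [← mul_apply, one_mul, mul_apply]
    simp only [hY, aeval_eta_last_apply]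
    rw [← mul_apply, one_mul]
  have hrec : ∀ k : Fin d, S k.castSucc.rev (Fin.last d) * ϕ k =
      (θs 0 - θs k.succ) * S k.succ.rev (Fin.last d) := by
    intro k
    -- In row `k.rev.castSucc` the superdiagonal entry is `ϕ k.rev.rev = ϕ k`.
    have h := congrFun (congrFun hBS k.rev.castSucc) (Fin.last d)
    rw [upperBidiagonal_mul_apply, mul_diagonal] at h
    simp only [Function.comp_apply, Fin.rev_last, Fin.rev_rev, Fin.rev_castSucc] at h
    rw [Fin.rev_castSucc, Fin.rev_succ]
    linear_combination h
  have hne : ∀ k : Fin (d + 1), S k.rev (Fin.last d) ≠ 0 := by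
    intro k
    induction k using Fin.induction with
    | zero =>
      rw [Fin.rev_zero, show S (Fin.last d) (Fin.last d) = 1 from hS.diag _]
      exact one_ne_zero
    | succ k ih =>
      intro h
      have := hrec k
      rw [h, mul_zero] at this
      exact mul_ne_zero ih (hϕ k) this
  rw [secondSplitSeq, eigenvalueSeq_primitiveIdempotent hθs hQ hBQ,
    eigenvalueSeq_primitiveIdempotent hθ hP hAP]
  have h1 := htr k.succ
  have h2 := htr k.castSucc
  rw [Fin.val_succ] at h1
  rw [Fin.val_castSucc] at h2
  rw [h1, h2, mul_div_assoc', ← hrec, mul_div_cancel_left₀ _ (hne _)]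

/-- `X` commutes with `A`, so it is diagonal in the eigenbasis of `A`. Conjugation by `P` leaves
superdiagonals unchanged, so the relation for `A*` fixes the ratios of consecutive eigenvalues of
`X`. -/
theorem exists_eq_smul_switchingElement (hθ : Function.Injective θ)
    (hφ : ∀ k, φ k ≠ 0) (hP : IsLowerUnitriangular P)
    (hAP : lowerBidiagonal θ * P = P * diagonal θ)
    {Es : Fin (d + 1) → Matrix (Fin (d + 1)) (Fin (d + 1)) K}
    {X : Matrix (Fin (d + 1)) (Fin (d + 1)) K} {ϕ : Fin d → K}
    (hAX : lowerBidiagonal θ * X = X * lowerBidiagonal θ)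
    (hBX : upperBidiagonal θs φ * X =
      X * upperBidiagonal (fun i => θs i.rev) (fun k => ϕ k.rev))
    (hfirst : firstSplitSeq (lowerBidiagonal θ) (primitiveIdempotent (lowerBidiagonal θ) θ)
      (upperBidiagonal θs φ) Es = φ)
    (hsecond : secondSplitSeq (lowerBidiagonal θ) (primitiveIdempotent (lowerBidiagonal θ) θ)
      (upperBidiagonal θs φ) Es = ϕ) :
    ∃ c : K, X = c • switchingElement (lowerBidiagonal θ)
      (primitiveIdempotent (lowerBidiagonal θ) θ) (upperBidiagonal θs φ) Es := by
  have hPd := (isUnit_iff_isUnit_det P).1 hP.isUnit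
  have hD := eq_diagonal_of_commute (Y := P⁻¹ * X * P) hθ (by
    rw [mul_assoc, ← mul_assoc, ← inv_mul_eq_of_mul_eq hP.isUnit hAP, mul_assoc,
      ← mul_assoc _ X, hAX, mul_assoc, hAP]
    simp only [mul_assoc])
  set x : Fin (d + 1) → K := fun i => (P⁻¹ * X * P) i i with hx
  have hXP : X = P * diagonal x * P⁻¹ := by
    rw [← hD]
    simp only [mul_assoc]
    rw [mul_nonsing_inv _ hPd, mul_one, mul_nonsing_inv_cancel_left _ _ hPd]
  have hrec : ∀ k : Fin d, φ k * x k.succ = x k.castSucc * ϕ k.rev := by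
    intro k
    have h : P⁻¹ * upperBidiagonal θs φ * P * diagonal x =
        diagonal x * (P⁻¹ * upperBidiagonal (fun i => θs i.rev) (fun k => ϕ k.rev) * P) := by
      rw [← hD]
      simp only [mul_assoc]
      rw [mul_nonsing_inv_cancel_left _ _ hPd, mul_nonsing_inv_cancel_left _ _ hPd,
        ← mul_assoc _ X, hBX, mul_assoc]
    have h' := congrFun (congrFun h k.castSucc) k.succ
    rw [mul_diagonal, diagonal_mul, hP.conj_upperBidiagonal_apply _ _ (by simp),
      hP.conj_upperBidiagonal_apply _ _ (by simp), upperBidiagonal_castSucc_succ,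
      upperBidiagonal_castSucc_succ] at h'
    exact h'
  let c : Fin (d + 1) → K := fun r =>
    (∏ h ∈ Finset.univ.filter (fun h : Fin d => (h : ℕ) < r), ϕ h.rev) /
      (∏ h ∈ Finset.univ.filter (fun h : Fin d => (h : ℕ) < r), φ h)
  have hxc : ∀ r, x r = x 0 * c r := by
    intro r
    induction r using Fin.induction with
    | zero => simp [c]
    | succ k ih =>
      have h1 : c k.succ = c k.castSucc * (ϕ k.rev / φ k) := by
        simp only [c, Fin.val_succ, Fin.val_castSucc]
        rw [prod_filter_val_lt_succ (fun h => ϕ h.rev), prod_filter_val_lt_succ φ,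
          mul_div_mul_comm]
      rw [h1, ← mul_assoc, ← ih, mul_div_assoc', ← hrec, mul_div_cancel_left₀ _ (hφ k)]
  -- The coefficient of `E_0` in the switching element is an empty product, so the scalar is the
  -- eigenvalue of `X` there.
  refine ⟨x 0, ?_⟩
  have hS : switchingElement (lowerBidiagonal θ) (primitiveIdempotent (lowerBidiagonal θ) θ)
      (upperBidiagonal θs φ) Es = P * diagonal c * P⁻¹ := by
    rw [switchingElement, hfirst, hsecond]
    have hsum : diagonal c = ∑ r, c r • (diagonal (Pi.single r 1) : Matrix _ _ K) := by
      ext i j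
      rw [Matrix.sum_apply]
      rcases eq_or_ne i j with rfl | hij
      · simp [Pi.single_apply]
      · simp [hij]
    rw [hsum, Finset.mul_sum, Finset.sum_mul]
    refine Finset.sum_congr rfl fun r _ => ?_
    rw [primitiveIdempotent_eq hθ hP.isUnit hAP, Matrix.mul_smul, Matrix.smul_mul]
  rw [hS, ← Matrix.smul_mul, ← Matrix.mul_smul, ← diagonal_smul, hXP]
  congr 3
  ext r
  exact hxc r

theorem conj_eq_iff {A X C : Matrix (Fin (d + 1)) (Fin (d + 1)) K} (hX : IsUnit X) :
    X⁻¹ * A * X = C ↔ A * X = X * C := by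
  constructor
  · rintro rfl
    exact mul_eq_mul_conj hX
  · intro h
    exact hX.mul_left_cancel (by rw [← mul_eq_mul_conj hX, h])

end Split

end Conjugation

end LeonardPairs

/-! ### The theorem. -/

theorem theorem13p1 {K : Type*} [Field K] (d : ℕ)
    (θ θs : Fin (d + 1) → K) (φ : Fin d → K)
    (hθ : Function.Injective θ) (hθs : Function.Injective θs) (hφ : ∀ k, φ k ≠ 0)
    (A As : Matrix (Fin (d + 1)) (Fin (d + 1)) K)
    (hA : A = LeonardPairs.lowerBidiagonal θ)
    (hAs : As = LeonardPairs.upperBidiagonal θs φ)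
    (E Es : Fin (d + 1) → Matrix (Fin (d + 1)) (Fin (d + 1)) K)
    (hE : E = LeonardPairs.primitiveIdempotent A θ)
    (hEs : Es = LeonardPairs.primitiveIdempotent As θs) :
    (LeonardPairs.IsLeonardPair (Matrix.toLin' A) (Matrix.toLin' As) ↔
      ∃ (X : Matrix (Fin (d + 1)) (Fin (d + 1)) K) (ϕ : Fin d → K),
        IsUnit X ∧ (∀ k, ϕ k ≠ 0) ∧ X⁻¹ * A * X = A ∧
        X⁻¹ * As * X =
          LeonardPairs.upperBidiagonal (fun i => θs i.rev) (fun k => ϕ k.rev)) ∧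
    (LeonardPairs.IsLeonardPair (Matrix.toLin' A) (Matrix.toLin' As) →
      LeonardPairs.IsLeonardSystem A E As Es ∧
      ∀ (X : Matrix (Fin (d + 1)) (Fin (d + 1)) K) (ϕ : Fin d → K),
        IsUnit X → (∀ k, ϕ k ≠ 0) → X⁻¹ * A * X = A →
        X⁻¹ * As * X =
          LeonardPairs.upperBidiagonal (fun i => θs i.rev) (fun k => ϕ k.rev) →
        (∀ k, ϕ k = LeonardPairs.secondSplitSeq A E As Es k) ∧
        ∃ c : K, X = c • LeonardPairs.switchingElement A E As Es) := by
  subst hA hAs hE hEs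
  obtain ⟨P, hP, hAP⟩ := LeonardPairs.exists_diagonalizer_lower (LeonardPairs.lowerBidiagonal_eq_zero_of_lt θ) hθ
    (LeonardPairs.lowerBidiagonal_diag θ)
  obtain ⟨Q, hQ, hBQ⟩ := LeonardPairs.exists_diagonalizer_upper (LeonardPairs.upperBidiagonal_isUpperTriangular θs φ) hθs
    (LeonardPairs.upperBidiagonal_diag θs φ)
  have hQu : IsUnit Q := (Matrix.isUnit_transpose Q).1 hQ.isUnit
  refine ⟨⟨fun h => ?_, ?_⟩, fun h => ?_⟩
  · obtain ⟨hM, hN⟩ :=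
      LeonardPairs.isIrredTridiagonal_of_isLeonardPair hθ hθs hφ hP hQ hAP hBQ h
    obtain ⟨X, ψ, hX, hψ, hAX, hBX⟩ := LeonardPairs.exists_switching hP hQ hAP hBQ hM hN
    refine ⟨X, fun k => ψ k.rev, hX, fun k => hψ _, (LeonardPairs.conj_eq_iff hX).2 hAX,
      (LeonardPairs.conj_eq_iff hX).2 ?_⟩
    simpa only [Fin.rev_rev] using hBX
  · rintro ⟨X, ϕ, hX, hϕ, hAX, hBX⟩
    obtain ⟨hM, hN⟩ := LeonardPairs.isIrredTridiagonal_of_switching hθ hθs hφ hP hQ hAP hBQ hX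
      ((LeonardPairs.conj_eq_iff hX).1 hAX) ((LeonardPairs.conj_eq_iff hX).1 hBX)
    exact LeonardPairs.isLeonardPair_of_isIrredTridiagonal hP.isUnit hQu hAP hBQ hM hN
  · obtain ⟨hM, hN⟩ :=
      LeonardPairs.isIrredTridiagonal_of_isLeonardPair hθ hθs hφ hP hQ hAP hBQ h
    refine ⟨LeonardPairs.isLeonardSystem_of_isIrredTridiagonal hθ hθs hP.isUnit hQu hAP hBQ hM hN,
      fun X ϕ hX hϕ hAX hBX => ?_⟩
    have hAX' := (LeonardPairs.conj_eq_iff hX).1 hAX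
    have hBX' := (LeonardPairs.conj_eq_iff hX).1 hBX
    have hsecond :=
      LeonardPairs.secondSplitSeq_eq hθ hθs hP.isUnit hQu hAP hBQ hX hϕ hAX' hBX'
    exact ⟨fun k => (hsecond k).symm, LeonardPairs.exists_eq_smul_switchingElement hθ hφ hP hAP
      hAX' hBX' (funext (LeonardPairs.firstSplitSeq_eq hθ hθs hφ hP.isUnit hQ hAP hBQ))
      (funext hsecond)⟩
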